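/- **Setting.** Let $p>2$ be a prime and let $f(x)=x^4+ax^2+bx+c\in\mathbb Z[x]$ be irreducible, with a root $\theta$, and let $K=\mathbb Q(\theta)$, with ring of integers $\mathbb Z_K$. Assume that $f$ has two different double roots modulo $p$ (in $\mathbb F_p$). Write $v_p$ for the $p$-adic valuation, $v_p(0)=\infty$. Assume that $b\neq0$ and $a^2\neq 4c$, and write $b=Bp^m$, $a^2-4c=Ap^{m'}$ with positive exponents $m,m'$ and integers $A,B$ not divisible by $p$. Put $r=\min\{m,m'\}$, $\delta=v_p(A^2+8aB^2)\in\mathbb Z_{\ge0}\cup\{\infty\}$ and $\Delta=v_p(\operatorname{disc}(f))$. **Terminology.** For $s\in\mathbb Z$ write $f(x)=\sum_k a_k(x-s)^k$ and $u_k=v_p(a_k)$. The principal $(x-s)$-Newton polygon of $f$ consists of the sides of negative slope of the lower convex envelope of the points $(k,u_k)$ with $a_k\ne0$. Consider such a side, with slope $-h/e$ in lowest terms, whose end points have abscissas $i<j=i+de$. Its residual polynomial is $\sum_{t=0}^{d}c_{i+te}\,y^t\in\mathbb F_p[y]$, where $c_k$ is the class of $a_k/p^{u_k}$ modulo $p$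 if $a_k\neq0$ and $(k,u_k)$ lies on the side, and $c_k=0$ otherwise. The integer $s$ is *regular* if the residual polynomials of all these sides are separable, and *irregular* otherwise. One step of the *iteration method* replaces an irregular $s$ by $t=s+yp^{\epsilon}$, where $-\epsilon$ is the (integral) slope of a side with inseparable residual polynomial, and $y$ is any integer whose class modulo $p$ is a multiple root of that polynomial. For integers $s$ such that $s$ and $-s$ are lifts of the two double roots, put $\nu_{\pm}=\lfloor\min\{v_p(f(\pm s))/2,\ v_p(f'(\pm s))\}\rfloor$. A *$p$-integral basis* of $K$ is a family of elements of $\mathbb Z_K$ which is a $\mathbb Z_{(p)}$-basis of $\mathbb Z_K\otimes_{\mathbb Z}\mathbb Z_{(p)}$. **Lemma.** 1. If $m\neq m'$ or $r\neq\delta$, then for every integer $s$ with $2s^2+a\equiv0\pmod{p^{r+1}}$ the integers $s$ and $-s$ are regular lifts of the two double roots of $f$ modulo $p$. 2. Suppose $m=m'=\delta$ and let $s$ be an irregular integer with $2s^2+a\equiv 0\pmod{p^{r+1}}$. A step of the iteration method can be applied to every irregular integer obtained from $s$ by this method; whatever choices are made, a regular integer is reached after finitely many steps; for every integer $t$ obtained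 from $s$ by finitely many (possibly zero) steps, $-t$ is regular; and if moreover $t$ is regular, then $t$ and $-t$ are regular lifts of the two double roots of $f$ modulo $p$. 3. We have $r\le\Delta$. If $s$ is any integer such that $s$ and $-s$ are regular lifts of the two double roots of $f$ modulo $p$, then $$\min\{\nu_-,\nu_+\}=\left\lfloor \frac r2\right\rfloor,\qquad \max\{\nu_-,\nu_+\}=\left\lfloor\frac{\Delta-r}2\right\rfloor.$$ If moreover $\nu_-\le\nu_+$ (which can be achieved by exchanging $s$ and $-s$), then $$1,\quad \theta,\quad \frac{\theta^2+s^2+a}{p^{\lfloor r/2\rfloor}},\quad \frac{\theta^3+s\theta^2+(a+s^2)\theta+s^3+as+b}{p^{\lfloor(\Delta-r)/2\rfloor}}$$ is a $p$-integral basis of $K$. -/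

import Mathlib

open Polynomial
open scoped ENNReal

noncomputable section

/-- The coefficients `a_k` of the `(X - s)`-adic development
`F = a_0 + a_1 (X - s) + a_2 (X - s)^2 + ⋯`. -/
def devCoeff (F : ℤ[X]) (s : ℤ) (k : ℕ) : ℤ := (taylor s F).coeff k

/-- The ordinate `u_k = v_p(a_k)` of the point of abscissa `k` of the `(X - s)`-Newton diagram of
`F`; it is only used when `a_k ≠ 0`. -/
def devVal (p : ℕ) (F : ℤ[X]) (s : ℤ) (k : ℕ) : ℕ := padicValInt p (devCoeff F s k)

/-- The lower convex envelope of the points `(k, u_k)`, `a_k ≠ 0`, has a side of negative slope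
with end points `(i, u_i)` and `(j, u_j)`, `i < j`. That is: no point of the diagram lies below the
line through these two points, and the points of the diagram on this line have abscissas between
`i` and `j`. -/
structure IsPrincipalSide (p : ℕ) (F : ℤ[X]) (s : ℤ) (i j : ℕ) : Prop where
  lt : i < j
  left_ne : devCoeff F s i ≠ 0
  right_ne : devCoeff F s j ≠ 0
  neg_slope : devVal p F s j < devVal p F s i
  above : ∀ k, devCoeff F s k ≠ 0 →
    ((j : ℤ) - k) * devVal p F s i + ((k : ℤ) - i) * devVal p F s j
      ≤ ((j : ℤ) - i) * devVal p F s k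
  strictly_above : ∀ k, devCoeff F s k ≠ 0 → (k < i ∨ j < k) →
    ((j : ℤ) - k) * devVal p F s i + ((k : ℤ) - i) * devVal p F s j
      < ((j : ℤ) - i) * devVal p F s k

open Classical in
/-- The residual coefficient `c_k` at an abscissa `k` of the side with end points of abscissas
`i < j`: the class of `a_k / p ^ u_k` modulo `p` if the point `(k, u_k)` exists and lies on the
side, and `0` otherwise. (The residue field attached to `X - s` is `ZMod p`.) -/
def residualCoeff (p : ℕ) (F : ℤ[X]) (s : ℤ) (i j k : ℕ) : ZMod p :=
  if devCoeff F s k ≠ 0 ∧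
      ((j : ℤ) - k) * devVal p F s i + ((k : ℤ) - i) * devVal p F s j
        = ((j : ℤ) - i) * devVal p F s k
  then ((devCoeff F s k / (p : ℤ) ^ devVal p F s k : ℤ) : ZMod p)
  else 0

/-- The degree `d` of the side with end points of abscissas `i < j`: the number of segments into
which the points with integral coordinates divide it. Its slope is `-h/e` in lowest terms, with
`j - i = d e` and `u_i - u_j = d h`. -/
def sideDegree (p : ℕ) (F : ℤ[X]) (s : ℤ) (i j : ℕ) : ℕ :=
  Nat.gcd (j - i) (devVal p F s i - devVal p F s j)

/-- The ramification index `e = (j - i) / d` of the side with end points of abscissas `i < j`. -/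
def sideRamIdx (p : ℕ) (F : ℤ[X]) (s : ℤ) (i j : ℕ) : ℕ :=
  (j - i) / sideDegree p F s i j

/-- The residual polynomial `c_i + c_{i+e} y + ⋯ + c_{i+de} y^d` of the side with end points of
abscissas `i < j`. -/
def residualPoly (p : ℕ) (F : ℤ[X]) (s : ℤ) (i j : ℕ) : (ZMod p)[X] :=
  ∑ t ∈ Finset.range (sideDegree p F s i j + 1),
    C (residualCoeff p F s i j (i + t * sideRamIdx p F s i j)) * X ^ t

/-- The integer `s` is regular (for `F` and `p`): `F` is `(X - s)`-regular, i.e. all the residual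
polynomials of the sides of the principal `(X - s)`-Newton polygon are separable. -/
def IsNewtonRegular (p : ℕ) (F : ℤ[X]) (s : ℤ) : Prop :=
  ∀ i j, IsPrincipalSide p F s i j → (residualPoly p F s i j).Separable

/-- `s` and `t` are regular lifts to `ℤ` of two different double roots of `F` modulo `p`. -/
structure AreRegularLifts (p : ℕ) (F : ℤ[X]) (s t : ℤ) : Prop where
  left_double : (F.map (Int.castRingHom (ZMod p))).rootMultiplicity (s : ZMod p) = 2
  right_double : (F.map (Int.castRingHom (ZMod p))).rootMultiplicity (t : ZMod p) = 2
  ne : (s : ZMod p) ≠ (t : ZMod p)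
  left_regular : IsNewtonRegular p F s
  right_regular : IsNewtonRegular p F t

/-- One step `s ↦ t = s + y p^δ` of the iteration method, at an irregular integer `s`: `-δ` is the
slope of a side whose residual polynomial is inseparable, and `y` is any integer whose class modulo
`p` is a multiple root of this residual polynomial. -/
def IterStep (p : ℕ) (F : ℤ[X]) (s t : ℤ) : Prop :=
  ∃ i j δ : ℕ, ∃ y : ℤ, IsPrincipalSide p F s i j ∧ ¬ (residualPoly p F s i j).Separable ∧
    devVal p F s i = devVal p F s j + δ * (j - i) ∧
    2 ≤ (residualPoly p F s i j).rootMultiplicity (y : ZMod p) ∧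
    t = s + y * (p : ℤ) ^ δ

/-- `t` is obtained from `s` by a finite number (possibly zero) of steps of the iteration. -/
def IsIterate (p : ℕ) (F : ℤ[X]) : ℤ → ℤ → Prop := Relation.ReflTransGen (IterStep p F)

/-- `⌊min {v_p(F(s)) / 2, v_p(F'(s))}⌋`, with `v_p(0) = ∞`. -/
def nuExp (p : ℕ) (F : ℤ[X]) (s : ℤ) : ℕ :=
  ⌊(min ((emultiplicity (p : ℤ) (F.eval s) : ℝ≥0∞) / 2)
    (emultiplicity (p : ℤ) (F.derivative.eval s) : ℝ≥0∞)).toReal⌋₊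

/-- A finite family of elements of a number field `K` is a `p`-integral basis of the ring of
integers `ℤ_K`: it consists of algebraic integers and it is a basis of the localization of `ℤ_K`
at `p` over `ℤ_(p)` (linearly independent, and every algebraic integer of `K` becomes an integral
linear combination of the family after multiplication by an integer prime to `p`). -/
structure IsPIntegralBasis (p : ℕ) {K : Type*} [Field K] [NumberField K] {n : ℕ}
    (ω : Fin n → K) : Prop where
  isIntegral : ∀ i, IsIntegral ℤ (ω i)
  linearIndependent : LinearIndependent ℚ ω
  span : ∀ x : K, IsIntegral ℤ x →
    ∃ d : ℤ, ¬ (p : ℤ) ∣ d ∧ d • x ∈ Submodule.span ℤ (Set.range ω)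

end

/-! ### Separability of linear and quadratic polynomials over a field. -/

section SmallDegree

variable {k : Type*} [Field k]

/-! Everything is read off from a factorization over `ℤ_[p]`, f = (X² + lX + n)(X² - lX + w), with l
a unit and each factor a square modulo p. Here l is the root near -2s of the resolvent sextic x⁶ +
2a x⁴ + (a² - 4c) x² - b², supplied by Hensel's lemma (`exists_padicFactorization`). Put d = l² -
4n, d' = l² - 4w and x = 2s + l, so that 4(s² + ls + n) = x² - d. The other factor is a unit at s,
so up to units f(s) is x² - d, and f'(s) is x modulo x² - d. Hence s is regular iff d ∣ x²
(`isNewtonRegular_iff`) and, exchanging the factors, -s is regular iff d' ∣ x². For regular s and -s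
the exponents ν₊, ν₋ are ⌊v(d)/2⌋ and ⌊v(d')/2⌋.

Two identities locate v(d) and v(d'). As p is odd, d and d' generate the same ideal as d + d' and d
- d', which is the ideal of b and a² - 4c; so min(v(d), v(d')) = r. The resultant of the two factors
is a unit, so v(d) + v(d') = Δ. Writing d d' in terms of A, B and l shows that v(d) > 2r forces m =
m' = δ (`not_pow_dvd_discr`). A step of the iteration raises the power of p known to divide x, and
v(d) is finite, so the iteration stops.

The last two members of the basis are integral because they satisfy quadratic equations with
integral coefficients. For spanning, an integral element is reduced to u + vX modulo each factor:
its trace and v²d lie in `ℤ_[p]`, which bounds the denominators, and the coefficients are recovered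
by elimination, the determinant being the unit resultant. -/

theorem separable_linear (u v : k) (hv : v ≠ 0) : (C u + C v * X : k[X]).Separable := by
  refine ⟨0, C v⁻¹, ?_⟩
  simp [← C_mul, hv]

theorem separable_quadratic (u v w : k) (hd : v ^ 2 - 4 * u * w ≠ 0) :
    (C u + C v * X + C w * X ^ 2 : k[X]).Separable := by
  set d := v ^ 2 - 4 * u * w with hd'
  -- Bézout relation from q'² - 4wq = v² - 4uw, where q is the quadratic.
  refine ⟨C (d⁻¹ * (-4 * w)), C d⁻¹ * (C v + C (2 * w) * X), ?_⟩
  have h1 : C d⁻¹ * C d = (1 : k[X]) := by rw [← C_mul, inv_mul_cancel₀ hd, C_1]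
  have c2 : (C 2 : k[X]) = 2 := map_ofNat C 2
  have c4 : (C 4 : k[X]) = 4 := map_ofNat C 4
  have h2 : (C d : k[X]) = C v ^ 2 - 4 * C u * C w := by
    rw [hd', C_sub, C_pow, C_mul, C_mul, c4]
  rw [← h1, h2]
  simp only [derivative_add, derivative_C, derivative_mul, derivative_X, derivative_X_pow, C_mul,
    C_neg, c2, c4, Nat.cast_ofNat]
  ring

theorem quadratic_eq_of_discr_eq_zero (u v w : k) (h2 : (2 : k) ≠ 0) (hw : w ≠ 0)
    (hd : v ^ 2 - 4 * u * w = 0) :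
    (C u + C v * X + C w * X ^ 2 : k[X]) = C w * (X - C (-v / (2 * w))) ^ 2 := by
  have h1 : u = w * (-v / (2 * w)) ^ 2 := by
    field_simp
    linear_combination (-1 : k) * hd
  have h3 : v = - 2 * w * (-v / (2 * w)) := by field_simp
  generalize -v / (2 * w) = y at *
  subst h1
  subst h3
  simp only [C_mul, C_pow, C_neg, map_ofNat]
  ring

theorem two_le_rootMultiplicity_quadratic_iff (u v w y : k) (h2 : (2 : k) ≠ 0) (hw : w ≠ 0)
    (hd : v ^ 2 - 4 * u * w = 0) :
    2 ≤ (C u + C v * X + C w * X ^ 2 : k[X]).rootMultiplicity y ↔ 2 * w * y + v = 0 := by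
  rw [quadratic_eq_of_discr_eq_zero u v w h2 hw hd]
  have hne : C w * (X - C (-v / (2 * w))) ^ 2 ≠ 0 :=
    mul_ne_zero (C_ne_zero.2 hw) (pow_ne_zero _ (X_sub_C_ne_zero _))
  constructor
  · intro h
    have hr := (rootMultiplicity_pos hne).1 (show 0 < _ by omega : 0 < rootMultiplicity y _)
    have h4 : y - -v / (2 * w) = 0 := by simpa [hw] using hr
    rw [sub_eq_zero.1 h4]
    field_simp
    ring
  · intro h
    rw [le_rootMultiplicity_iff hne]
    have : -v / (2 * w) = y := by
      field_simp
      linear_combination (-1 : k) * h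
    rw [this]
    exact Dvd.intro_left _ rfl

theorem not_separable_quadratic (u v w : k) (h2 : (2 : k) ≠ 0) (hw : w ≠ 0)
    (hd : v ^ 2 - 4 * u * w = 0) : ¬ (C u + C v * X + C w * X ^ 2 : k[X]).Separable := by
  intro h
  have h1 := rootMultiplicity_le_one_of_separable h (-v / (2 * w))
  have h3 := (two_le_rootMultiplicity_quadratic_iff u v w (-v / (2 * w)) h2 hw hd).2
    (by field_simp; ring)
  omega

end SmallDegree

/-- The numerical form of irregularity at `s`, with slope `-h`, when `s` is a double root of
`F` modulo `p`. -/
structure IrregularSlope (p : ℕ) (F : ℤ[X]) (s : ℤ) (h : ℕ) : Prop where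
  dvd_zero : (p : ℤ) ^ (2 * h) ∣ devCoeff F s 0
  not_dvd_zero : ¬ (p : ℤ) ^ (2 * h + 1) ∣ devCoeff F s 0
  dvd_one : (p : ℤ) ^ h ∣ devCoeff F s 1
  dvd_discr : (p : ℤ) ^ (2 * h + 1) ∣
    devCoeff F s 1 ^ 2 - 4 * devCoeff F s 0 * devCoeff F s 2

/-! ### Newton polygons at a double root: irregularity as divisibility. -/

section Newton

variable {p : ℕ} {F : ℤ[X]} {s : ℤ}

theorem devVal_eq_zero {k : ℕ} (h : ¬ (p : ℤ) ∣ devCoeff F s k) : devVal p F s k = 0 := by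
  rw [devVal, padicValInt.eq_zero_of_not_dvd h]

/-- The point of abscissa 2 has height 0, so the envelope cannot descend beyond it. -/
theorem IsPrincipalSide.le_two {i j : ℕ} (h2 : ¬ (p : ℤ) ∣ devCoeff F s 2)
    (H : IsPrincipalSide p F s i j) : j ≤ 2 := by
  have hne : devCoeff F s 2 ≠ 0 := fun h => h2 (by simp [h])
  have hv := devVal_eq_zero h2
  by_contra hj
  push Not at hj
  have h3 := H.above 2 hne
  have hlt := H.neg_slope
  have hij := H.lt
  rw [hv] at h3
  rcases lt_trichotomy i 2 with hi | hi | hi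
  · have h4 : (0 : ℤ) < ((j : ℤ) - 2) * devVal p F s i :=
      mul_pos (by omega) (by omega)
    have h5 : (0 : ℤ) ≤ ((2 : ℤ) - i) * devVal p F s j :=
      mul_nonneg (by omega) (by omega)
    push_cast at h3
    linarith
  · subst hi
    omega
  · have h4 := H.strictly_above 2 hne (Or.inl hi)
    rw [hv] at h4
    have h5 : (0 : ℤ) < ((j : ℤ) - i) * devVal p F s i := mul_pos (by omega) (by omega)
    have h6 : (0 : ℤ) ≤ ((i : ℤ) - 2) * ((devVal p F s i : ℤ) - devVal p F s j) :=
      mul_nonneg (by omega) (by omega)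
    push_cast at h4
    nlinarith

variable [hp : Fact p.Prime]

theorem pow_dvd_devCoeff_iff {k n : ℕ} (h : devCoeff F s k ≠ 0) :
    (p : ℤ) ^ n ∣ devCoeff F s k ↔ n ≤ devVal p F s k := by
  rw [devVal, padicValInt_dvd_iff]
  simp [h]

theorem isPrincipalSide_zero_two {h : ℕ} (hh : 0 < h) (h2 : ¬ (p : ℤ) ∣ devCoeff F s 2)
    (h0 : devCoeff F s 0 ≠ 0) (hv : devVal p F s 0 = 2 * h)
    (h1 : (p : ℤ) ^ h ∣ devCoeff F s 1) : IsPrincipalSide p F s 0 2 := by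
  have hv2 := devVal_eq_zero h2
  refine ⟨by omega, h0, fun h => h2 (by simp [h]), by omega, fun k hk => ?_, fun k hk hk' => ?_⟩
  · rw [hv, hv2]
    rcases Nat.lt_or_ge k 2 with hk2 | hk2
    · interval_cases k
      · rw [hv]; simp
      · rw [pow_dvd_devCoeff_iff hk] at h1
        push_cast
        omega
    · have : (0 : ℤ) ≤ ((k : ℤ) - 2) * (2 * h) := mul_nonneg (by omega) (by omega)
      push_cast
      nlinarith
  · rw [hv, hv2]
    have : (0 : ℤ) < ((k : ℤ) - 2) * (2 * h) := mul_pos (by omega) (by omega)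
    push_cast
    nlinarith

theorem residualCoeff_right_ne_zero {i j : ℕ} (H : IsPrincipalSide p F s i j) :
    residualCoeff p F s i j j ≠ 0 := by
  rw [residualCoeff, if_pos ⟨H.right_ne, by ring⟩, Ne, ZMod.intCast_zmod_eq_zero_iff_dvd]
  have hd : (p : ℤ) ^ devVal p F s j ∣ devCoeff F s j :=
    (pow_dvd_devCoeff_iff H.right_ne).2 le_rfl
  intro hdv
  have := mul_dvd_mul_left ((p : ℤ) ^ devVal p F s j) hdv
  rw [Int.mul_ediv_cancel' hd, ← pow_succ, pow_dvd_devCoeff_iff H.right_ne] at this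
  omega

theorem separable_residualPoly_of_sideDegree_eq_one {i j : ℕ} (H : IsPrincipalSide p F s i j)
    (hd : sideDegree p F s i j = 1) : (residualPoly p F s i j).Separable := by
  have he : i + 1 * sideRamIdx p F s i j = j := by
    rw [sideRamIdx, hd]
    have := H.lt
    omega
  rw [residualPoly, hd, Finset.sum_range_succ, Finset.sum_range_one, he]
  simpa using separable_linear (residualCoeff p F s i j i) _ (residualCoeff_right_ne_zero H)

/-- The middle coefficient needs no case distinction: if the point of abscissa 1 is missing or above
the side, a₁/p^h is already 0 modulo p. -/
theorem residualPoly_zero_two {h : ℕ} (h2 : ¬ (p : ℤ) ∣ devCoeff F s 2)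
    (H : IsPrincipalSide p F s 0 2) (hv : devVal p F s 0 = 2 * h)
    (h1 : (p : ℤ) ^ h ∣ devCoeff F s 1) :
    residualPoly p F s 0 2 = C ((devCoeff F s 0 / (p : ℤ) ^ (2 * h) : ℤ) : ZMod p)
      + C ((devCoeff F s 1 / (p : ℤ) ^ h : ℤ) : ZMod p) * X
      + C ((devCoeff F s 2 : ℤ) : ZMod p) * X ^ 2 := by
  have hv2 := devVal_eq_zero h2
  have hd : sideDegree p F s 0 2 = 2 := by
    rw [sideDegree, hv, hv2]
    simp
  have he : sideRamIdx p F s 0 2 = 1 := by rw [sideRamIdx, hd]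
  have c0 : residualCoeff p F s 0 2 0 = ((devCoeff F s 0 / (p : ℤ) ^ (2 * h) : ℤ) : ZMod p) := by
    rw [residualCoeff, if_pos ⟨H.left_ne, by push_cast; ring⟩, hv]
  have c2 : residualCoeff p F s 0 2 2 = ((devCoeff F s 2 : ℤ) : ZMod p) := by
    rw [residualCoeff, if_pos ⟨H.right_ne, by push_cast; ring⟩, hv2]
    simp
  have c1 : residualCoeff p F s 0 2 1 = ((devCoeff F s 1 / (p : ℤ) ^ h : ℤ) : ZMod p) := by
    rw [residualCoeff]
    split_ifs with hc
    · have : devVal p F s 1 = h := by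
        have := hc.2
        rw [hv, hv2] at this
        push_cast at this
        omega
      rw [this]
    · symm
      rw [ZMod.intCast_zmod_eq_zero_iff_dvd]
      by_cases h10 : devCoeff F s 1 = 0
      · simp [h10]
      · have hle := (pow_dvd_devCoeff_iff h10).1 h1
        have hlt : h + 1 ≤ devVal p F s 1 := by
          by_contra hcon
          apply hc
          refine ⟨h10, ?_⟩
          rw [hv, hv2]
          push_cast
          omega
        have := (pow_dvd_devCoeff_iff h10).2 hlt
        rw [pow_succ] at this
        exact Int.dvd_div_of_mul_dvd this
  rw [residualPoly, hd, he, Finset.sum_range_succ, Finset.sum_range_succ, Finset.sum_range_one]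
  simp only [zero_add, mul_one]
  rw [c0, c1, c2]
  simp

theorem residual_discr_eq_zero_iff {h : ℕ} (h0 : (p : ℤ) ^ (2 * h) ∣ devCoeff F s 0)
    (h1 : (p : ℤ) ^ h ∣ devCoeff F s 1) :
    (((devCoeff F s 1 / (p : ℤ) ^ h : ℤ) : ZMod p)) ^ 2
      - 4 * ((devCoeff F s 0 / (p : ℤ) ^ (2 * h) : ℤ) : ZMod p) * ((devCoeff F s 2 : ℤ) : ZMod p) = 0
      ↔ (p : ℤ) ^ (2 * h + 1) ∣ devCoeff F s 1 ^ 2 - 4 * devCoeff F s 0 * devCoeff F s 2 := by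
  have hp0 : (p : ℤ) ≠ 0 := by exact_mod_cast hp.out.ne_zero
  obtain ⟨x, hx⟩ := h0
  obtain ⟨y, hy⟩ := h1
  rw [hx, hy, Int.mul_ediv_cancel_left _ (pow_ne_zero _ hp0),
    Int.mul_ediv_cancel_left _ (pow_ne_zero _ hp0)]
  have e1 : ((p : ℤ) ^ h * y) ^ 2 - 4 * ((p : ℤ) ^ (2 * h) * x) * devCoeff F s 2
      = (p : ℤ) ^ (2 * h) * (y ^ 2 - 4 * x * devCoeff F s 2) := by ring
  rw [e1, pow_succ (p : ℤ), mul_dvd_mul_iff_left (pow_ne_zero _ hp0),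
    ← ZMod.intCast_zmod_eq_zero_iff_dvd]
  push_cast
  rfl

theorem zmod_two_ne_zero (hp2 : 2 < p) : (2 : ZMod p) ≠ 0 := by
  have : ((2 : ℕ) : ZMod p) ≠ 0 := by
    rw [Ne, ZMod.natCast_eq_zero_iff]
    exact fun h => absurd (Nat.le_of_dvd (by norm_num) h) (by omega)
  exact_mod_cast this

/-- The data attached to a side with inseparable residual polynomial. -/
theorem irregularSlope_of_not_separable {i j : ℕ}
    (h2 : ¬ (p : ℤ) ∣ devCoeff F s 2) (H : IsPrincipalSide p F s i j)
    (hs : ¬ (residualPoly p F s i j).Separable) :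
    i = 0 ∧ j = 2 ∧ ∃ h, devVal p F s 0 = 2 * h ∧ IrregularSlope p F s h := by
  have hj := H.le_two h2
  have hij := H.lt
  have hdeg : sideDegree p F s i j ≠ 1 := fun hd =>
    hs (separable_residualPoly_of_sideDegree_eq_one H hd)
  have hi0 : i = 0 ∧ j = 2 := by
    by_contra hcon
    apply hdeg
    rw [sideDegree]
    have : j - i = 1 := by omega
    rw [this, Nat.gcd_one_left]
  obtain ⟨rfl, rfl⟩ := hi0
  have hv2 := devVal_eq_zero h2
  refine ⟨rfl, rfl, ?_⟩
  have heven : 2 ∣ devVal p F s 0 := by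
    by_contra hodd
    apply hdeg
    rw [sideDegree, hv2]
    exact (Nat.Prime.coprime_iff_not_dvd Nat.prime_two).2 hodd
  obtain ⟨h, hh⟩ := heven
  have hd0 : (p : ℤ) ^ (2 * h) ∣ devCoeff F s 0 := (pow_dvd_devCoeff_iff H.left_ne).2 hh.ge
  have hd1 : (p : ℤ) ^ h ∣ devCoeff F s 1 := by
    by_cases h10 : devCoeff F s 1 = 0
    · simp [h10]
    · rw [pow_dvd_devCoeff_iff h10]
      have := H.above 1 h10
      rw [hh, hv2] at this
      push_cast at this
      omega
  refine ⟨h, hh, hd0, ?_, hd1, ?_⟩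
  · rw [pow_dvd_devCoeff_iff H.left_ne]
    omega
  · rw [← residual_discr_eq_zero_iff hd0 hd1]
    by_contra hcon
    apply hs
    rw [residualPoly_zero_two h2 H hh hd1]
    exact separable_quadratic _ _ _ hcon

theorem IrregularSlope.isPrincipalSide {h : ℕ} (h2 : ¬ (p : ℤ) ∣ devCoeff F s 2)
    (h0 : (p : ℤ) ∣ devCoeff F s 0) (I : IrregularSlope p F s h) :
    IsPrincipalSide p F s 0 2 ∧ devVal p F s 0 = 2 * h := by
  have h0ne : devCoeff F s 0 ≠ 0 := fun hz => I.not_dvd_zero (by simp [hz])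
  have hv : devVal p F s 0 = 2 * h := by
    have h3 := (pow_dvd_devCoeff_iff h0ne).1 I.dvd_zero
    have h4 := mt (pow_dvd_devCoeff_iff h0ne).2 I.not_dvd_zero
    omega
  have hh : 0 < h := by
    rcases Nat.eq_zero_or_pos h with rfl | h
    · exact absurd (by simpa using h0) I.not_dvd_zero
    · exact h
  exact ⟨isPrincipalSide_zero_two hh h2 h0ne hv I.dvd_one, hv⟩

/-- A side of degree 1 has a linear residual polynomial, so only a side from 0 to 2 of even height
2h can fail; its residual polynomial is quadratic and fails exactly when its discriminant vanishes.
-/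
theorem not_isNewtonRegular_iff (hp2 : 2 < p) (h2 : ¬ (p : ℤ) ∣ devCoeff F s 2)
    (h0 : (p : ℤ) ∣ devCoeff F s 0) :
    ¬ IsNewtonRegular p F s ↔ ∃ h, IrregularSlope p F s h := by
  constructor
  · intro hn
    rw [IsNewtonRegular] at hn
    push Not at hn
    obtain ⟨i, j, H, hs⟩ := hn
    obtain ⟨-, -, h, -, hI⟩ := irregularSlope_of_not_separable h2 H hs
    exact ⟨h, hI⟩
  · rintro ⟨h, I⟩ hreg
    obtain ⟨H, hv⟩ := I.isPrincipalSide h2 h0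
    have := hreg 0 2 H
    rw [residualPoly_zero_two h2 H hv I.dvd_one] at this
    exact not_separable_quadratic _ _ _ (zmod_two_ne_zero hp2)
      (by rwa [Ne, ZMod.intCast_zmod_eq_zero_iff_dvd])
      ((residual_discr_eq_zero_iff I.dvd_zero I.dvd_one).2 I.dvd_discr) this

theorem IrregularSlope.two_le_rootMultiplicity_iff (hp2 : 2 < p) {h : ℕ} (y : ℤ)
    (h2 : ¬ (p : ℤ) ∣ devCoeff F s 2) (h0 : (p : ℤ) ∣ devCoeff F s 0)
    (I : IrregularSlope p F s h) :
    2 ≤ (residualPoly p F s 0 2).rootMultiplicity (y : ZMod p) ↔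
      (p : ℤ) ^ (h + 1) ∣ 2 * devCoeff F s 2 * (y * (p : ℤ) ^ h) + devCoeff F s 1 := by
  have hp0 : (p : ℤ) ≠ 0 := by exact_mod_cast hp.out.ne_zero
  obtain ⟨H, hv⟩ := I.isPrincipalSide h2 h0
  rw [residualPoly_zero_two h2 H hv I.dvd_one,
    two_le_rootMultiplicity_quadratic_iff _ _ _ _ (zmod_two_ne_zero hp2)
      (by rwa [Ne, ZMod.intCast_zmod_eq_zero_iff_dvd])
      ((residual_discr_eq_zero_iff I.dvd_zero I.dvd_one).2 I.dvd_discr)]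
  obtain ⟨x, hx⟩ := I.dvd_one
  rw [hx, Int.mul_ediv_cancel_left _ (pow_ne_zero _ hp0)]
  have e : 2 * devCoeff F s 2 * (y * (p : ℤ) ^ h) + (p : ℤ) ^ h * x
      = (p : ℤ) ^ h * (2 * devCoeff F s 2 * y + x) := by ring
  rw [e, pow_succ, mul_dvd_mul_iff_left (pow_ne_zero _ hp0), ← ZMod.intCast_zmod_eq_zero_iff_dvd]
  push_cast
  rfl

theorem IterStep.exists_irregularSlope (hp2 : 2 < p) {t : ℤ} (h2 : ¬ (p : ℤ) ∣ devCoeff F s 2)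
    (h0 : (p : ℤ) ∣ devCoeff F s 0) (st : IterStep p F s t) :
    ∃ h, ∃ y : ℤ, IrregularSlope p F s h ∧ t = s + y * (p : ℤ) ^ h ∧
      (p : ℤ) ^ (h + 1) ∣ 2 * devCoeff F s 2 * (y * (p : ℤ) ^ h) + devCoeff F s 1 := by
  obtain ⟨i, j, e, y, H, hs, hv, hm, rfl⟩ := st
  obtain ⟨rfl, rfl, h, hh, I⟩ := irregularSlope_of_not_separable h2 H hs
  have : e = h := by
    rw [hh, devVal_eq_zero h2] at hv
    omega
  subst this
  exact ⟨e, y, I, rfl, (I.two_le_rootMultiplicity_iff hp2 y h2 h0).1 hm⟩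

theorem exists_iterStep (hp2 : 2 < p) (h2 : ¬ (p : ℤ) ∣ devCoeff F s 2)
    (h0 : (p : ℤ) ∣ devCoeff F s 0) (hn : ¬ IsNewtonRegular p F s) : ∃ t, IterStep p F s t := by
  obtain ⟨h, I⟩ := (not_isNewtonRegular_iff hp2 h2 h0).1 hn
  obtain ⟨H, hv⟩ := I.isPrincipalSide h2 h0
  have hc2 : ((devCoeff F s 2 : ℤ) : ZMod p) ≠ 0 := by
    rwa [Ne, ZMod.intCast_zmod_eq_zero_iff_dvd]
  have h2' := zmod_two_ne_zero hp2
  have hd := (residual_discr_eq_zero_iff I.dvd_zero I.dvd_one).2 I.dvd_discr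
  -- For odd p the double root of the residual quadratic is -c₁/(2c₂), hence lies in the prime
  -- field.
  obtain ⟨y, hy⟩ := ZMod.intCast_surjective
    (-((devCoeff F s 1 / (p : ℤ) ^ h : ℤ) : ZMod p) / (2 * ((devCoeff F s 2 : ℤ) : ZMod p)))
  refine ⟨_, 0, 2, h, y, H, ?_, ?_, ?_, rfl⟩
  · rw [residualPoly_zero_two h2 H hv I.dvd_one]
    exact not_separable_quadratic _ _ _ h2' hc2 hd
  · rw [hv, devVal_eq_zero h2]
    ring
  · rw [residualPoly_zero_two h2 H hv I.dvd_one,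
      two_le_rootMultiplicity_quadratic_iff _ _ _ _ h2' hc2 hd, hy]
    field_simp
    ring

end Newton

/-- The quartic `X⁴ + a X² + b X + c`. -/
noncomputable def depressedQuartic {R : Type*} [CommRing R] (a b c : R) : R[X] :=
  X ^ 4 + C a * X ^ 2 + C b * X + C c

/-! ### The quartic, its derivative and its Taylor coefficients. -/

section Quartic

variable {R : Type*} [CommRing R] (a b c : R)

theorem depressedQuartic_map {S : Type*} [CommRing S] (φ : R →+* S) :
    (depressedQuartic a b c).map φ = depressedQuartic (φ a) (φ b) (φ c) := by
  simp [depressedQuartic]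

theorem depressedQuartic_natDegree [Nontrivial R] : (depressedQuartic a b c).natDegree = 4 := by
  rw [depressedQuartic]
  compute_degree!

theorem depressedQuartic_monic : (depressedQuartic a b c).Monic := by
  rw [depressedQuartic]
  monicity!

theorem depressedQuartic_eval (x : R) :
    (depressedQuartic a b c).eval x = x ^ 4 + a * x ^ 2 + b * x + c := by
  simp [depressedQuartic]

theorem depressedQuartic_derivative_eval (x : R) :
    (derivative (depressedQuartic a b c)).eval x = 4 * x ^ 3 + 2 * a * x + b := by
  simp [depressedQuartic]
  ring

end Quartic

section DevCoeff

variable (a b c s : ℤ)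

theorem taylor_depressedQuartic : taylor s (depressedQuartic a b c) =
    C (s ^ 4 + a * s ^ 2 + b * s + c) + C (4 * s ^ 3 + 2 * a * s + b) * X
      + C (6 * s ^ 2 + a) * X ^ 2 + C (4 * s) * X ^ 3 + X ^ 4 := by
  simp only [depressedQuartic, taylor_apply, add_comp, mul_comp, pow_comp, X_comp, C_comp]
  simp only [C_add, C_mul, C_pow, map_ofNat]
  ring

theorem devCoeff_zero : devCoeff (depressedQuartic a b c) s 0 = s ^ 4 + a * s ^ 2 + b * s + c := by
  rw [devCoeff, taylor_coeff_zero, depressedQuartic_eval]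

theorem devCoeff_one : devCoeff (depressedQuartic a b c) s 1 = 4 * s ^ 3 + 2 * a * s + b := by
  rw [devCoeff, taylor_depressedQuartic]
  simp only [coeff_add, coeff_C_mul, coeff_X, coeff_C, coeff_X_pow]
  norm_num

theorem devCoeff_two : devCoeff (depressedQuartic a b c) s 2 = 6 * s ^ 2 + a := by
  rw [devCoeff, taylor_depressedQuartic]
  simp only [coeff_add, coeff_C_mul, coeff_X, coeff_C, coeff_X_pow]
  norm_num

end DevCoeff

/-! ### Double roots of the quartic over a field of characteristic not 2. -/

section DoubleRoots

variable {k : Type*} [Field k] {a b c : k}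

/-- Under these conditions the quartic is (X - s)²(X + s)², and s ≠ -s. -/
theorem rootMultiplicity_depressedQuartic_eq_two (h2 : (2 : k) ≠ 0) (ha : a ≠ 0) (hb : b = 0)
    (hc : a ^ 2 - 4 * c = 0) {s : k} (hs : 2 * s ^ 2 + a = 0) :
    (depressedQuartic a b c).rootMultiplicity s = 2 := by
  have hs0 : s ≠ 0 := by
    rintro rfl
    exact ha (by simpa using hs)
  have ha' : a = -(2 * s ^ 2) := by linear_combination hs
  have hc' : c = s ^ 4 := by
    have h4 : (4 : k) ≠ 0 := by
      have : (4 : k) = 2 * 2 := by norm_num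
      rw [this]
      exact mul_ne_zero h2 h2
    apply mul_left_cancel₀ h4
    rw [ha'] at hc
    linear_combination -hc
  have e : depressedQuartic a b c = (X - C s) ^ 2 * (X - C (-s)) ^ 2 := by
    have c2 : (C 2 : k[X]) = 2 := map_ofNat C 2
    rw [depressedQuartic, ha', hb, hc']
    simp only [C_neg, C_mul, C_pow, c2, C_0]
    ring
  have hne : (X - C s) ^ 2 * (X - C (-s)) ^ 2 ≠ 0 :=
    mul_ne_zero (pow_ne_zero _ (X_sub_C_ne_zero _)) (pow_ne_zero _ (X_sub_C_ne_zero _))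
  rw [e, rootMultiplicity_mul hne, rootMultiplicity_X_sub_C_pow,
    rootMultiplicity_eq_zero]
  simp only [IsRoot.def, eval_pow, eval_sub, eval_X, eval_C]
  have : s - -s = 2 * s := by ring
  rw [this]
  exact pow_ne_zero _ (mul_ne_zero h2 hs0)

theorem derivative_eq_zero_of_rootMultiplicity_eq_two (h2 : (2 : k) ≠ 0) (hb : b = 0) {s : k}
    (h : (depressedQuartic a b c).rootMultiplicity s = 2) : s = 0 ∨ 2 * s ^ 2 + a = 0 := by
  have h1 := ((one_lt_rootMultiplicity_iff_isRoot (depressedQuartic_monic a b c).ne_zero).1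
    (by omega : 1 < (depressedQuartic a b c).rootMultiplicity s)).2
  rw [IsRoot.def, depressedQuartic_derivative_eval, hb] at h1
  have h3 : 2 * (s * (2 * s ^ 2 + a)) = 0 := by linear_combination h1
  simpa [h2] using h3

end DoubleRoots

/-- `l`, `n`, `w` are the coefficients of a factorization
`X⁴ + a X² + b X + c = (X² + l X + n) (X² - l X + w)` over `ℤ_[p]`, with `l` a unit, and with
factors which are squares modulo `p`. -/
structure PadicFactorization (p : ℕ) [Fact p.Prime] (a b c : ℤ) (l n w : ℤ_[p]) : Prop where
  sum : n + w = l ^ 2 + a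
  diff : l * (w - n) = b
  prod : n * w = c
  unit : ¬ (p : ℤ_[p]) ∣ l
  left_dvd : (p : ℤ_[p]) ∣ l ^ 2 - 4 * n
  right_dvd : (p : ℤ_[p]) ∣ l ^ 2 - 4 * w

/-! ### Existence of the factorization over the p-adic integers. -/

section PadicFactorization

variable {p : ℕ} [hp : Fact p.Prime] {a b c : ℤ} {l n w : ℤ_[p]}

theorem PadicFactorization.symm (H : PadicFactorization p a b c l n w) :
    PadicFactorization p a b c (-l) w n :=
  ⟨by rw [add_comm, H.sum]; ring, by rw [← H.diff]; ring, by rw [mul_comm, H.prod],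
    by rw [dvd_neg]; exact H.unit, by simpa using H.right_dvd, by simpa using H.left_dvd⟩

theorem padicInt_not_dvd_two (hp2 : 2 < p) : ¬ (p : ℤ_[p]) ∣ 2 := by
  have := (PadicInt.pow_p_dvd_int_iff (p := p) 1 2)
  rw [pow_one, pow_one] at this
  intro h
  have h2 := Int.le_of_dvd (by norm_num) (this.1 (by exact_mod_cast h))
  omega

theorem padicInt_dvd_intCast_iff {x : ℤ} : (p : ℤ_[p]) ∣ (x : ℤ_[p]) ↔ (p : ℤ) ∣ x := by
  simpa using PadicInt.pow_p_dvd_int_iff (p := p) 1 x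

theorem padicInt_isUnit_of_not_dvd {x : ℤ_[p]} (h : ¬ (p : ℤ_[p]) ∣ x) : IsUnit x := by
  rw [← PadicInt.norm_lt_one_iff_dvd] at h
  rw [PadicInt.isUnit_iff]
  exact le_antisymm (PadicInt.norm_le_one x) (not_lt.1 h)

/-- A form of Hensel's lemma. -/
theorem padicInt_exists_root (F : ℤ_[p][X]) (x : ℤ_[p]) (h0 : (p : ℤ_[p]) ∣ F.eval x)
    (h1 : ¬ (p : ℤ_[p]) ∣ (derivative F).eval x) :
    ∃ z : ℤ_[p], F.eval z = 0 ∧ (p : ℤ_[p]) ∣ z - x := by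
  rw [← PadicInt.norm_lt_one_iff_dvd] at h0
  have h1' := PadicInt.isUnit_iff.1 (padicInt_isUnit_of_not_dvd h1)
  obtain ⟨z, hz, hz', -⟩ := hensels_lemma (F := F) (a := x)
    (by simpa [aeval_def, eval₂_eq_eval_map, h1'] using h0)
  refine ⟨z, by simpa [aeval_def, eval₂_eq_eval_map] using hz, ?_⟩
  rw [← PadicInt.norm_lt_one_iff_dvd]
  simpa [aeval_def, eval₂_eq_eval_map, h1'] using hz'

theorem exists_padicFactorization (hp2 : 2 < p) (ha : ¬ (p : ℤ) ∣ a) (hb : (p : ℤ) ∣ b)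
    (hD : (p : ℤ) ∣ a ^ 2 - 4 * c) {s : ℤ} (hs : (p : ℤ) ∣ 2 * s ^ 2 + a) :
    ∃ l n w : ℤ_[p], PadicFactorization p a b c l n w ∧ (p : ℤ_[p]) ∣ 2 * s + l := by
  have hP := PadicInt.prime_p (p := p)
  have h2 := padicInt_not_dvd_two hp2
  rw [← padicInt_dvd_intCast_iff (p := p)] at ha hb hD hs
  push_cast at hb hD hs
  have hs0 : ¬ (p : ℤ_[p]) ∣ s := fun h => ha (by
    rw [← dvd_add_right (Dvd.dvd.mul_left (dvd_pow h two_ne_zero) 2)]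
    exact hs)
  -- Solving the sum and difference conditions for n and w and substituting in nw = c gives this
  -- sextic in l. Modulo p it is x⁴(x² + 2a), with simple root -2s since 4s² ≡ -2a.
  let F : ℤ_[p][X] := X ^ 6 + C (2 * (a : ℤ_[p])) * X ^ 4
    + C ((a : ℤ_[p]) ^ 2 - 4 * c) * X ^ 2 - C ((b : ℤ_[p]) ^ 2)
  have hF : ∀ x, F.eval x = x ^ 6 + 2 * a * x ^ 4 + (a ^ 2 - 4 * c) * x ^ 2 - b ^ 2 := by
    intro x
    simp [F]
  have hF' : ∀ x, (derivative F).eval x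
      = 6 * x ^ 5 + 8 * a * x ^ 3 + 2 * (a ^ 2 - 4 * c) * x := by
    have key : ∀ u v w x : ℤ_[p], (derivative (X ^ 6 + C u * X ^ 4 + C v * X ^ 2 - C w)).eval x
        = 6 * x ^ 5 + 4 * u * x ^ 3 + 2 * v * x := by
      intro u v w x
      simp
      ring
    intro x
    rw [key]
    ring
  obtain ⟨l, hl, hls⟩ := padicInt_exists_root F (-(2 * s)) (by
      rw [hF]
      have e : (-(2 * (s : ℤ_[p]))) ^ 6 + 2 * a * (-(2 * s)) ^ 4 + (a ^ 2 - 4 * c) * (-(2 * s)) ^ 2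
          - b ^ 2 = (32 * s ^ 4) * (2 * s ^ 2 + a) + (a ^ 2 - 4 * c) * (4 * s ^ 2) - b * b := by ring
      rw [e]
      exact dvd_sub (dvd_add (hs.mul_left _) (hD.mul_right _)) (hb.mul_right _)) (by
      rw [hF']
      have e : 6 * (-(2 * (s : ℤ_[p]))) ^ 5 + 8 * a * (-(2 * s)) ^ 3
          + 2 * (a ^ 2 - 4 * c) * (-(2 * s)) = (2 * s ^ 2 + a) * (-(64 * s ^ 3))
            + (a ^ 2 - 4 * c) * (-(4 * s)) + -(2 ^ 6 * s ^ 5) := by ring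
      rw [e, dvd_add_right (dvd_add (hs.mul_right _) (hD.mul_right _)), dvd_neg]
      intro h
      rcases hP.dvd_or_dvd h with h | h
      · exact h2 (hP.dvd_of_dvd_pow h)
      · exact hs0 (hP.dvd_of_dvd_pow h))
  rw [hF] at hl
  have hls' : (p : ℤ_[p]) ∣ 2 * s + l := by
    have : 2 * (s : ℤ_[p]) + l = l - -(2 * s) := by ring
    rwa [this]
  have hlu : ¬ (p : ℤ_[p]) ∣ l := fun h => by
    rcases hP.dvd_or_dvd ((dvd_add_left h).1 hls') with h | h
    · exact h2 h
    · exact hs0 h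
  obtain ⟨li, hli⟩ := (padicInt_isUnit_of_not_dvd hlu).exists_right_inv
  obtain ⟨t, ht⟩ := (padicInt_isUnit_of_not_dvd h2).exists_right_inv
  have hla : (p : ℤ_[p]) ∣ l ^ 2 + 2 * a := by
    have e : l ^ 2 + 2 * a = (2 * s + l) * (l - 2 * s) + 2 * (2 * s ^ 2 + a) := by ring
    rw [e]
    exact dvd_add (hls'.mul_right _) (hs.mul_left _)
  -- Here t = 1/2 and li = 1/l, so n and w are (l² + a ∓ b/l)/2.
  refine ⟨l, t * (l ^ 2 + a - li * b), t * (l ^ 2 + a + li * b),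
    ⟨?_, ?_, ?_, hlu, ?_, ?_⟩, hls'⟩
  · linear_combination (l ^ 2 + a) * ht
  · linear_combination l * li * b * ht + b * hli
  · have e : (l * li) ^ 2 * (2 * t) ^ 2 * (c : ℤ_[p])
        = (l * li) ^ 2 * t ^ 2 * ((l ^ 2 + a) ^ 2) - li ^ 2 * t ^ 2 * b ^ 2 := by
      linear_combination -(li ^ 2 * t ^ 2) * hl
    rw [hli, ht] at e
    linear_combination -e
  · have e : l ^ 2 - 4 * (t * (l ^ 2 + a - li * b)) = -(l ^ 2 + 2 * a) + b * (2 * li) := by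
      linear_combination (-2 * (l ^ 2 + a - li * b)) * ht
    rw [e]
    exact dvd_add ((dvd_neg).2 hla) (hb.mul_right _)
  · have e : l ^ 2 - 4 * (t * (l ^ 2 + a + li * b)) = -(l ^ 2 + 2 * a) + b * (-(2 * li)) := by
      linear_combination (-2 * (l ^ 2 + a + li * b)) * ht
    rw [e]
    exact dvd_add ((dvd_neg).2 hla) (hb.mul_right _)

end PadicFactorization

/-! ### Divisibility by powers of p in the p-adic integers. -/

section PadicDvd

variable {p : ℕ} [hp : Fact p.Prime]

theorem padicInt_pow_dvd_iff {x : ℤ_[p]} (hx : x ≠ 0) (n : ℕ) :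
    (p : ℤ_[p]) ^ n ∣ x ↔ n ≤ x.valuation := by
  rw [← Ideal.mem_span_singleton, PadicInt.mem_span_pow_iff_le_valuation x hx]

/-- The valuation of a square is even, so an odd n may be rounded up. -/
theorem padicInt_pow_dvd_sq {x : ℤ_[p]} {n k : ℕ} (hk : 2 * k ≤ n + 1)
    (h : (p : ℤ_[p]) ^ n ∣ x ^ 2) : (p : ℤ_[p]) ^ k ∣ x := by
  by_cases hx : x = 0
  · simp [hx]
  · rw [padicInt_pow_dvd_iff (pow_ne_zero 2 hx), PadicInt.valuation_pow] at h
    rw [padicInt_pow_dvd_iff hx]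
    omega

theorem padicInt_dvd_of_pow_dvd {x y : ℤ_[p]} {n : ℕ} (hx : ¬ (p : ℤ_[p]) ^ (n + 1) ∣ x)
    (hy : (p : ℤ_[p]) ^ n ∣ y) : x ∣ y := by
  have hx0 : x ≠ 0 := fun h => hx (by simp [h])
  have hv : x.valuation ≤ n := by
    rw [padicInt_pow_dvd_iff hx0] at hx
    omega
  have e := PadicInt.unitCoeff_spec hx0
  rw [e, (Units.isUnit _).mul_left_dvd]
  exact (pow_dvd_pow _ hv).trans hy

theorem padicInt_pow_dvd_mul_right {x u : ℤ_[p]} {n : ℕ} (hu : ¬ (p : ℤ_[p]) ∣ u) :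
    (p : ℤ_[p]) ^ n ∣ x * u ↔ (p : ℤ_[p]) ^ n ∣ x :=
  (padicInt_isUnit_of_not_dvd hu).dvd_mul_right

theorem padicInt_pow_dvd_mul_left {x u : ℤ_[p]} {n : ℕ} (hu : ¬ (p : ℤ_[p]) ∣ u) :
    (p : ℤ_[p]) ^ n ∣ u * x ↔ (p : ℤ_[p]) ^ n ∣ x :=
  (padicInt_isUnit_of_not_dvd hu).dvd_mul_left

theorem padicInt_not_dvd_pow {u : ℤ_[p]} (hu : ¬ (p : ℤ_[p]) ∣ u) (k : ℕ) :
    ¬ (p : ℤ_[p]) ∣ u ^ k := fun h => hu (PadicInt.prime_p.dvd_of_dvd_pow h)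

theorem padicInt_not_dvd_mul {u v : ℤ_[p]} (hu : ¬ (p : ℤ_[p]) ∣ u) (hv : ¬ (p : ℤ_[p]) ∣ v) :
    ¬ (p : ℤ_[p]) ∣ u * v := fun h => (PadicInt.prime_p.dvd_or_dvd h).elim hu hv

theorem padicInt_not_dvd_four (hp2 : 2 < p) : ¬ (p : ℤ_[p]) ∣ 4 := by
  have := padicInt_not_dvd_mul (padicInt_not_dvd_two hp2) (padicInt_not_dvd_two hp2)
  norm_num at this
  exact this

end PadicDvd

/-! ### Regularity and the iteration in terms of 2s + l and l² - 4n. -/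

section Link

variable {p : ℕ} [hp : Fact p.Prime] {a b c : ℤ} {l n w : ℤ_[p]}

namespace PadicFactorization

variable (H : PadicFactorization p a b c l n w)
include H

theorem devCoeff_zero (s : ℤ) : (devCoeff (depressedQuartic a b c) s 0 : ℤ_[p])
    = (s ^ 2 + l * s + n) * (s ^ 2 - l * s + w) := by
  rw [_root_.devCoeff_zero]
  push_cast
  linear_combination (-(s : ℤ_[p]) ^ 2) * H.sum - s * H.diff - H.prod

theorem devCoeff_one (s : ℤ) : (devCoeff (depressedQuartic a b c) s 1 : ℤ_[p])
    = (2 * s + l) * (s ^ 2 - l * s + w) + (s ^ 2 + l * s + n) * (2 * s - l) := by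
  rw [_root_.devCoeff_one]
  push_cast
  linear_combination (-2 * (s : ℤ_[p])) * H.sum - H.diff

theorem devCoeff_two (s : ℤ) : (devCoeff (depressedQuartic a b c) s 2 : ℤ_[p])
    = (s ^ 2 - l * s + w) + (2 * s + l) * (2 * s - l) + (s ^ 2 + l * s + n) := by
  rw [_root_.devCoeff_two]
  push_cast
  linear_combination -H.sum

/-- Four times the cofactor is (2s - l)² - (l² - 4w), and 2s - l ≡ -2l is a unit. -/
theorem not_dvd_cofactor (hp2 : 2 < p) {s : ℤ} (hs : (p : ℤ_[p]) ∣ 2 * s + l) :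
    ¬ (p : ℤ_[p]) ∣ s ^ 2 - l * s + w := by
  intro h
  have e : (2 * s - l) ^ 2 = 4 * (s ^ 2 - l * s + w) + (l ^ 2 - 4 * w) := by ring
  have h1 : (p : ℤ_[p]) ∣ (2 * s - l) ^ 2 := by
    rw [e]
    exact dvd_add (h.mul_left _) H.right_dvd
  have h2 := PadicInt.prime_p.dvd_of_dvd_pow h1
  have h3 := dvd_sub hs h2
  have e3 : 2 * (s : ℤ_[p]) + l - (2 * s - l) = 2 * l := by ring
  rw [e3] at h3
  exact padicInt_not_dvd_mul (padicInt_not_dvd_two hp2) H.unit h3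

omit H in
theorem pow_dvd_factor_iff (hp2 : 2 < p) (s : ℤ) (k : ℕ) :
    (p : ℤ_[p]) ^ k ∣ s ^ 2 + l * s + n ↔
      (p : ℤ_[p]) ^ k ∣ (2 * s + l) ^ 2 - (l ^ 2 - 4 * n) := by
  have e : (2 * s + l) ^ 2 - (l ^ 2 - 4 * n) = 4 * (s ^ 2 + l * s + n) := by ring
  rw [e, padicInt_pow_dvd_mul_left (padicInt_not_dvd_four hp2)]

theorem dvd_factor (hp2 : 2 < p) {s : ℤ} (hs : (p : ℤ_[p]) ∣ 2 * s + l) :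
    (p : ℤ_[p]) ∣ s ^ 2 + l * s + n := by
  have := (pow_dvd_factor_iff (l := l) (n := n) hp2 s 1).2
  rw [pow_one] at this
  exact this (dvd_sub (dvd_pow hs two_ne_zero) H.left_dvd)

theorem dvd_devCoeff_zero (hp2 : 2 < p) {s : ℤ} (hs : (p : ℤ_[p]) ∣ 2 * s + l) :
    (p : ℤ) ∣ devCoeff (depressedQuartic a b c) s 0 := by
  rw [← padicInt_dvd_intCast_iff (p := p), H.devCoeff_zero]
  exact (H.dvd_factor hp2 hs).mul_right _

theorem not_dvd_devCoeff_two (hp2 : 2 < p) {s : ℤ} (hs : (p : ℤ_[p]) ∣ 2 * s + l) :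
    ¬ (p : ℤ) ∣ devCoeff (depressedQuartic a b c) s 2 := by
  rw [← padicInt_dvd_intCast_iff (p := p), H.devCoeff_two,
    dvd_add_left (H.dvd_factor hp2 hs), dvd_add_left (hs.mul_right _)]
  exact H.not_dvd_cofactor hp2 hs

theorem dvd_double (hp2 : 2 < p) {s : ℤ} (hs : (p : ℤ_[p]) ∣ 2 * s + l) :
    (p : ℤ) ∣ 2 * s ^ 2 + a := by
  rw [← padicInt_dvd_intCast_iff (p := p)]
  push_cast
  have e : 4 * (2 * (s : ℤ_[p]) ^ 2 + a) = 2 * ((2 * s + l) * (2 * s - l))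
      - ((l ^ 2 - 4 * n) + (l ^ 2 - 4 * w)) := by
    linear_combination (-4 : ℤ_[p]) * H.sum
  refine (PadicInt.prime_p.dvd_or_dvd (a := (4 : ℤ_[p])) ?_).resolve_left
    (padicInt_not_dvd_four hp2)
  rw [e]
  exact dvd_sub ((hs.mul_right _).mul_left _) (dvd_add H.left_dvd H.right_dvd)

theorem pow_dvd_devCoeff_one (hp2 : 2 < p) {s : ℤ} (hs : (p : ℤ_[p]) ∣ 2 * s + l) {N k : ℕ}
    (hk : k ≤ N) (h0 : (p : ℤ_[p]) ^ N ∣ s ^ 2 + l * s + n) :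
    (p : ℤ) ^ k ∣ devCoeff (depressedQuartic a b c) s 1 ↔ (p : ℤ_[p]) ^ k ∣ 2 * s + l := by
  rw [← PadicInt.pow_p_dvd_int_iff, H.devCoeff_one,
    dvd_add_left (((pow_dvd_pow _ hk).trans h0).mul_right _),
    padicInt_pow_dvd_mul_right (H.not_dvd_cofactor hp2 hs)]

theorem pow_dvd_devCoeff_zero (hp2 : 2 < p) {s : ℤ} (hs : (p : ℤ_[p]) ∣ 2 * s + l) (k : ℕ) :
    (p : ℤ) ^ k ∣ devCoeff (depressedQuartic a b c) s 0 ↔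
      (p : ℤ_[p]) ^ k ∣ s ^ 2 + l * s + n := by
  rw [← PadicInt.pow_p_dvd_int_iff, H.devCoeff_zero,
    padicInt_pow_dvd_mul_right (H.not_dvd_cofactor hp2 hs)]

theorem pow_dvd_discr_iff (hp2 : 2 < p) {s : ℤ} (hs : (p : ℤ_[p]) ∣ 2 * s + l) {h k : ℕ}
    (hh : 0 < h) (hk : k ≤ 2 * h + 1)
    (h0 : (p : ℤ_[p]) ^ (2 * h) ∣ s ^ 2 + l * s + n) (h1 : (p : ℤ_[p]) ^ h ∣ 2 * s + l) :
    (p : ℤ) ^ k ∣ devCoeff (depressedQuartic a b c) s 1 ^ 2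
        - 4 * devCoeff (depressedQuartic a b c) s 0 * devCoeff (depressedQuartic a b c) s 2
      ↔ (p : ℤ_[p]) ^ k ∣ l ^ 2 - 4 * n := by
  have hW := H.not_dvd_cofactor hp2 hs
  rw [← PadicInt.pow_p_dvd_int_iff]
  push_cast
  rw [H.devCoeff_one, H.devCoeff_zero, H.devCoeff_two]
  have hd : l ^ 2 - 4 * n = (2 * s + l) ^ 2 - 4 * (s ^ 2 + l * s + n) := by ring
  rw [hd]
  generalize (s : ℤ_[p]) ^ 2 - l * s + w = W at *
  generalize (s : ℤ_[p]) ^ 2 + l * s + n = ν at *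
  generalize 2 * (s : ℤ_[p]) + l = x at *
  generalize 2 * (s : ℤ_[p]) - l = U at *
  -- The error terms are multiples of xν and ν², hence of p^(3h); this covers k ≤ 2h + 1 because h >
  -- 0.
  have e : (x * W + ν * U) ^ 2 - 4 * (ν * W) * (W + x * U + ν)
      = (x ^ 2 - 4 * ν) * W ^ 2 + ((x * ν) * (-2 * W * U) + (ν * ν) * (U ^ 2 - 4 * W)) := by ring
  have h2 : (p : ℤ_[p]) ^ k ∣ x * ν :=
    (pow_dvd_pow _ (by omega : k ≤ h + 2 * h)).trans (by rw [pow_add]; exact mul_dvd_mul h1 h0)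
  have h3 : (p : ℤ_[p]) ^ k ∣ ν * ν :=
    (pow_dvd_pow _ (by omega : k ≤ 2 * h + 2 * h)).trans (by rw [pow_add]; exact mul_dvd_mul h0 h0)
  rw [e, dvd_add_left (dvd_add (h2.mul_right _) (h3.mul_right _)),
    padicInt_pow_dvd_mul_right (padicInt_not_dvd_pow hW 2)]

/-- Since 4(s² + ls + n) = (2s + l)² - (l² - 4n), once p^(2h+1) divides l² - 4n the factor has
valuation exactly 2h iff 2s + l has valuation h. -/
theorem irregularSlope_iff (hp2 : 2 < p) {s : ℤ} (hs : (p : ℤ_[p]) ∣ 2 * s + l) (h : ℕ) :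
    IrregularSlope p (depressedQuartic a b c) s h ↔
      (p : ℤ_[p]) ^ h ∣ 2 * s + l ∧ ¬ (p : ℤ_[p]) ^ (h + 1) ∣ 2 * s + l ∧
        (p : ℤ_[p]) ^ (2 * h + 1) ∣ l ^ 2 - 4 * n := by
  constructor
  · intro I
    have h0 := (H.pow_dvd_devCoeff_zero hp2 hs _).1 I.dvd_zero
    have h0' := mt (H.pow_dvd_devCoeff_zero hp2 hs _).2 I.not_dvd_zero
    have hh : 0 < h := by
      rcases Nat.eq_zero_or_pos h with rfl | h
      · exact absurd (H.dvd_factor hp2 hs) (by simpa using h0')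
      · exact h
    have h1 := (H.pow_dvd_devCoeff_one hp2 hs (by omega) h0).1 I.dvd_one
    have hd := (H.pow_dvd_discr_iff hp2 hs hh le_rfl h0 h1).1 I.dvd_discr
    refine ⟨h1, fun hcon => h0' ?_, hd⟩
    rw [pow_dvd_factor_iff hp2]
    refine dvd_sub ((pow_dvd_pow _ (by omega : 2 * h + 1 ≤ (h + 1) * 2)).trans ?_) hd
    rw [pow_mul]
    exact pow_dvd_pow_of_dvd hcon 2
  · rintro ⟨h1, h1', hd⟩
    have hh : 0 < h := by
      rcases Nat.eq_zero_or_pos h with rfl | h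
      · exact absurd hs (by simpa using h1')
      · exact h
    have hsq : (p : ℤ_[p]) ^ (2 * h) ∣ (2 * s + l) ^ 2 := by
      rw [mul_comm, pow_mul]
      exact pow_dvd_pow_of_dvd h1 2
    have h0 : (p : ℤ_[p]) ^ (2 * h) ∣ s ^ 2 + l * s + n := by
      rw [pow_dvd_factor_iff hp2]
      exact dvd_sub hsq ((pow_dvd_pow _ (by omega)).trans hd)
    refine ⟨(H.pow_dvd_devCoeff_zero hp2 hs _).2 h0, fun hcon => h1' ?_,
      (H.pow_dvd_devCoeff_one hp2 hs (by omega) h0).2 h1,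
      (H.pow_dvd_discr_iff hp2 hs hh le_rfl h0 h1).2 hd⟩
    rw [H.pow_dvd_devCoeff_zero hp2 hs, pow_dvd_factor_iff hp2, dvd_sub_left hd] at hcon
    exact padicInt_pow_dvd_sq (by omega) hcon

theorem not_isNewtonRegular_iff (hp2 : 2 < p) {s : ℤ} (hs : (p : ℤ_[p]) ∣ 2 * s + l) :
    ¬ IsNewtonRegular p (depressedQuartic a b c) s ↔
      ∃ h, (p : ℤ_[p]) ^ h ∣ 2 * s + l ∧ ¬ (p : ℤ_[p]) ^ (h + 1) ∣ 2 * s + l ∧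
        (p : ℤ_[p]) ^ (2 * h + 1) ∣ l ^ 2 - 4 * n := by
  rw [_root_.not_isNewtonRegular_iff hp2 (H.not_dvd_devCoeff_two hp2 hs)
    (H.dvd_devCoeff_zero hp2 hs)]
  exact exists_congr fun h => H.irregularSlope_iff hp2 hs h

/-- Irregularity means that v(l² - 4n) exceeds 2v(2s + l) with 2s + l ≠ 0; in a discrete valuation
ring its negation is this divisibility. -/
theorem isNewtonRegular_iff (hp2 : 2 < p) {s : ℤ} (hs : (p : ℤ_[p]) ∣ 2 * s + l) :
    IsNewtonRegular p (depressedQuartic a b c) s ↔ l ^ 2 - 4 * n ∣ (2 * s + l) ^ 2 := by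
  rw [← not_iff_not, H.not_isNewtonRegular_iff hp2 hs]
  constructor
  · rintro ⟨h, -, h2, h3⟩ hcon
    exact h2 (padicInt_pow_dvd_sq (by omega) (h3.trans hcon))
  · intro hcon
    have hx : 2 * (s : ℤ_[p]) + l ≠ 0 := fun h => hcon (by simp [h])
    refine ⟨(2 * (s : ℤ_[p]) + l).valuation, ?_, ?_, ?_⟩
    · rw [padicInt_pow_dvd_iff hx]
    · rw [padicInt_pow_dvd_iff hx]
      omega
    · by_contra h
      refine hcon (padicInt_dvd_of_pow_dvd h ?_)
      rw [padicInt_pow_dvd_iff (pow_ne_zero 2 hx), PadicInt.valuation_pow]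

/-- Under a step of the iteration, the distance to the centre of the factor decreases. -/
theorem pow_dvd_of_iterStep (hp2 : 2 < p) {s t : ℤ} (hs : (p : ℤ_[p]) ∣ 2 * s + l)
    (st : IterStep p (depressedQuartic a b c) s t) {k : ℕ} (hk : (p : ℤ_[p]) ^ k ∣ 2 * s + l) :
    (p : ℤ_[p]) ^ (k + 1) ∣ 2 * t + l := by
  obtain ⟨h, y, I, rfl, hd⟩ := st.exists_irregularSlope hp2 (H.not_dvd_devCoeff_two hp2 hs)
    (H.dvd_devCoeff_zero hp2 hs)
  obtain ⟨h1, h2, -⟩ := (H.irregularSlope_iff hp2 hs h).1 I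
  have h0 := (H.pow_dvd_devCoeff_zero hp2 hs _).1 I.dvd_zero
  have hkh : k ≤ h := by
    by_contra hcon
    exact h2 ((pow_dvd_pow _ (by omega)).trans hk)
  have hh : 0 < h := by
    rcases Nat.eq_zero_or_pos h with rfl | h
    · exact absurd hs (by simpa using h2)
    · exact h
  refine (pow_dvd_pow _ (by omega : k + 1 ≤ h + 1)).trans ?_
  rw [← PadicInt.pow_p_dvd_int_iff] at hd
  push_cast at hd ⊢
  rw [H.devCoeff_two, H.devCoeff_one] at hd
  have hW := H.not_dvd_cofactor hp2 hs
  have e2 : 2 * (s + y * (p : ℤ_[p]) ^ h) + l = (2 * s + l) + 2 * y * p ^ h := by ring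
  rw [e2]
  generalize (s : ℤ_[p]) ^ 2 - l * s + w = W at *
  generalize (s : ℤ_[p]) ^ 2 + l * s + n = ν at *
  generalize 2 * (s : ℤ_[p]) + l = x at *
  generalize 2 * (s : ℤ_[p]) - l = U at *
  have hx : (p : ℤ_[p]) ^ (h + 1) ∣ p ^ h * x := by
    rw [pow_succ]
    exact mul_dvd_mul_left _ hs
  have hν : (p : ℤ_[p]) ^ (h + 1) ∣ ν := (pow_dvd_pow _ (by omega)).trans h0
  -- Modulo p^(h+1) the condition on y says that the new value of 2s + l, times the unit W,
  -- vanishes.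
  have e : 2 * (W + x * U + ν) * (y * (p : ℤ_[p]) ^ h) + (x * W + ν * U)
      = (x + 2 * y * p ^ h) * W + ((p ^ h * x) * (2 * U * y) + ν * (2 * y * p ^ h + U)) := by ring
  rw [e, dvd_add_left (dvd_add (hx.mul_right _) (hν.mul_right _)),
    padicInt_pow_dvd_mul_right hW] at hd
  exact hd

/-- This computes ν₊. Without regularity, f(s) and f'(s) only bound v(l² - 4n) from below;
regularity passes divisibility from l² - 4n to (2s + l)², hence back to f(s) and f'(s). -/
theorem pow_dvd_dev_iff (hp2 : 2 < p) {s : ℤ} (hs : (p : ℤ_[p]) ∣ 2 * s + l)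
    (hreg : IsNewtonRegular p (depressedQuartic a b c) s) (N : ℕ) :
    ((p : ℤ) ^ (2 * N) ∣ (depressedQuartic a b c).eval s ∧
      (p : ℤ) ^ N ∣ (derivative (depressedQuartic a b c)).eval s) ↔
      (p : ℤ_[p]) ^ (2 * N) ∣ l ^ 2 - 4 * n := by
  have e0 : (depressedQuartic a b c).eval s = devCoeff (depressedQuartic a b c) s 0 := by
    rw [devCoeff, taylor_coeff_zero]
  have e1 : (derivative (depressedQuartic a b c)).eval s
      = devCoeff (depressedQuartic a b c) s 1 := by
    rw [devCoeff, taylor_coeff_one]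
  rw [e0, e1]
  rw [H.isNewtonRegular_iff hp2 hs] at hreg
  constructor
  · rintro ⟨h0, h1⟩
    rw [H.pow_dvd_devCoeff_zero hp2 hs] at h0
    rw [H.pow_dvd_devCoeff_one hp2 hs (by omega) h0] at h1
    rw [pow_dvd_factor_iff hp2, dvd_sub_right] at h0
    · exact h0
    · rw [mul_comm, pow_mul]
      exact pow_dvd_pow_of_dvd h1 2
  · intro hd
    have hx := hd.trans hreg
    have h0 := (pow_dvd_factor_iff hp2 s (2 * N)).2 (dvd_sub hx hd)
    exact ⟨(H.pow_dvd_devCoeff_zero hp2 hs _).2 h0,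
      (H.pow_dvd_devCoeff_one hp2 hs (by omega) h0).2 (padicInt_pow_dvd_sq (by omega) hx)⟩

end PadicFactorization

end Link

/-! ### The discriminant of a product of two monic quadratics. -/

section Discriminant

variable {R : Type*} [CommRing R]

/-- The quadratic `X² + l X + n`. -/
noncomputable def monicQuadratic (l n : R) : R[X] := X ^ 2 + C l * X + C n

theorem monicQuadratic_coeff_zero (l n : R) : (monicQuadratic l n).coeff 0 = n := by
  simp [monicQuadratic]

theorem monicQuadratic_coeff_one (l n : R) : (monicQuadratic l n).coeff 1 = l := by
  simp [monicQuadratic, coeff_C, coeff_X_pow]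

theorem monicQuadratic_coeff_two (l n : R) : (monicQuadratic l n).coeff 2 = 1 := by
  simp [monicQuadratic]

theorem monicQuadratic_natDegree [Nontrivial R] (l n : R) : (monicQuadratic l n).natDegree = 2 := by
  rw [monicQuadratic]
  compute_degree!

theorem monicQuadratic_monic (l n : R) : (monicQuadratic l n).Monic := by
  rw [monicQuadratic]
  monicity!

theorem monicQuadratic_mul {a b c l n w : R} (h1 : n + w = l ^ 2 + a) (h2 : l * (w - n) = b)
    (h3 : n * w = c) :
    monicQuadratic l n * monicQuadratic (-l) w = depressedQuartic a b c := by
  rw [← h2, ← h3, (eq_sub_of_add_eq' h1.symm : a = n + w - l ^ 2)]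
  simp only [monicQuadratic, depressedQuartic, C_neg, C_sub, C_add, C_mul, C_pow]
  ring

theorem resultant_monicQuadratic (l n l' n' : R) :
    resultant (monicQuadratic l n) (monicQuadratic l' n') 2 2
      = (n - n') ^ 2 + (l - l') * (l * n' - l' * n) := by
  have : sylvester (monicQuadratic l n) (monicQuadratic l' n') 2 2 =
      !![n', 0, n, 0; l', n', l, n; 1, l', 1, l; 0, 1, 0, 1] := by
    ext i j
    fin_cases i <;> fin_cases j <;>
      simp [sylvester, Fin.addCases, monicQuadratic_coeff_zero, monicQuadratic_coeff_one,
        monicQuadratic_coeff_two]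
  rw [resultant, this, Matrix.det_succ_row_zero]
  simp [Fin.sum_univ_succ, Matrix.det_fin_three, Fin.succAbove]
  ring

variable [CharZero R]

theorem resultant_monicQuadratic_derivative (l n : R) :
    resultant (monicQuadratic l n) (derivative (monicQuadratic l n)) 2 1 = -(l ^ 2 - 4 * n) := by
  have hd := monicQuadratic_natDegree l n
  have hdeg : (monicQuadratic l n).degree = 2 := by
    rw [degree_eq_natDegree (monicQuadratic_monic l n).ne_zero, hd]
    rfl
  have := resultant_deriv (f := monicQuadratic l n) (by rw [hdeg]; norm_num)
  rw [hd, (monicQuadratic_monic l n).leadingCoeff, discr_of_degree_eq_two hdeg,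
    monicQuadratic_coeff_zero, monicQuadratic_coeff_one, monicQuadratic_coeff_two] at this
  simpa using this

variable [IsDomain R]

/-- Modulo g one has (gh)' ≡ g'h, so Res(g, (gh)') = Res(g, g') Res(g, h). -/
theorem resultant_monicQuadratic_derivative_mul (l n l' n' : R) :
    resultant (monicQuadratic l n)
        (derivative (monicQuadratic l n * monicQuadratic l' n')) 2 3
      = -(l ^ 2 - 4 * n) * ((n - n') ^ 2 + (l - l') * (l * n' - l' * n)) := by
  have hd := monicQuadratic_natDegree l n
  have hd' := monicQuadratic_natDegree l' n'
  have h1 : (derivative (monicQuadratic l n)).natDegree = 1 := by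
    rw [natDegree_derivative, hd]
  have h1' : (derivative (monicQuadratic l' n')).natDegree = 1 := by
    rw [natDegree_derivative, hd']
  rw [derivative_mul, resultant_add_mul_right _ _ _ _ _ (by omega) (by omega)]
  have := resultant_mul_right (monicQuadratic l n) (derivative (monicQuadratic l n))
    (monicQuadratic l' n') 2 hd.le
  rw [h1, hd', resultant_monicQuadratic_derivative, resultant_monicQuadratic] at this
  exact this

theorem discr_depressedQuartic {a b c l n w : R} (h1 : n + w = l ^ 2 + a) (h2 : l * (w - n) = b)
    (h3 : n * w = c) : (depressedQuartic a b c).discr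
      = (l ^ 2 - 4 * n) * (l ^ 2 - 4 * w) * ((n - w) ^ 2 + 2 * l ^ 2 * (n + w)) ^ 2 := by
  have hd := depressedQuartic_natDegree a b c
  have hdeg : 0 < (depressedQuartic a b c).degree := by
    rw [← natDegree_pos_iff_degree_pos, hd]
    norm_num
  have e := resultant_deriv hdeg
  rw [hd, (depressedQuartic_monic a b c).leadingCoeff, ← monicQuadratic_mul h1 h2 h3] at e
  have hm := resultant_mul_left (monicQuadratic l n) (monicQuadratic (-l) w)
    (derivative (monicQuadratic l n * monicQuadratic (-l) w)) 3 (by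
      rw [monicQuadratic_mul h1 h2 h3, natDegree_derivative, hd])
  rw [monicQuadratic_natDegree, monicQuadratic_natDegree,
    resultant_monicQuadratic_derivative_mul] at hm
  rw [mul_comm (monicQuadratic l n), resultant_monicQuadratic_derivative_mul,
    mul_comm (monicQuadratic (-l) w)] at hm
  rw [monicQuadratic_mul h1 h2 h3] at hm e
  norm_num at e hm
  rw [← e, hm]
  ring

/-- The comparison goes through the resultant with the derivative, which commutes with ring
homomorphisms; characteristic zero preserves the degrees. -/
theorem discr_intCast (f : ℤ[X]) (hf : f.Monic) (h0 : 0 < f.natDegree) :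
    (f.map (Int.castRingHom R)).discr = (f.discr : R) := by
  have hinj : Function.Injective (Int.castRingHom R) := Int.cast_injective
  have hd := natDegree_map_eq_of_injective hinj f
  have h1 := resultant_deriv (f := f) (natDegree_pos_iff_degree_pos.1 h0)
  have h2 := resultant_deriv (f := f.map (Int.castRingHom R))
    (natDegree_pos_iff_degree_pos.1 (by rwa [hd]))
  rw [hd, derivative_map, resultant_map_map, h1, (hf.map _).leadingCoeff, hf.leadingCoeff] at h2
  simp only [map_mul, map_pow, map_neg, map_one, mul_one] at h2
  exact (mul_left_cancel₀ (pow_ne_zero _ (neg_ne_zero.2 one_ne_zero)) h2).symm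

end Discriminant

theorem discr_ne_zero_of_irreducible {f : ℤ[X]} (hf : f.Monic) (hirr : Irreducible f) :
    f.discr ≠ 0 := by
  have hirr' : Irreducible (f.map (Int.castRingHom ℚ)) :=
    (IsPrimitive.Int.irreducible_iff_irreducible_map_cast hf.isPrimitive).1 hirr
  have hinj : Function.Injective (Int.castRingHom ℚ) := Int.cast_injective
  have h0 : 0 < (f.map (Int.castRingHom ℚ)).natDegree :=
    hirr'.natDegree_pos
  have hd := natDegree_map_eq_of_injective hinj f
  have hr := resultant_ne_zero _ _ hirr'.separable
  rw [natDegree_derivative, resultant_deriv (natDegree_pos_iff_degree_pos.1 h0)] at hr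
  have := right_ne_zero_of_mul hr
  rw [discr_intCast f hf (by rwa [hd] at h0)] at this
  exact_mod_cast this

theorem nuExp_eq_of_forall {p : ℕ} {F : ℤ[X]} {s : ℤ} {k : ℕ}
    (hk : ∀ N, ((p : ℤ) ^ (2 * N) ∣ F.eval s ∧ (p : ℤ) ^ N ∣ (derivative F).eval s) ↔ N ≤ k) : nuExp p F s = k := by
  set x : ℝ≥0∞ := min ((emultiplicity (p : ℤ) (F.eval s) : ℝ≥0∞) / 2)
    (emultiplicity (p : ℤ) (F.derivative.eval s) : ℝ≥0∞) with hx
  have hle : ∀ N : ℕ, (N : ℝ≥0∞) ≤ x ↔ N ≤ k := by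
    intro N
    rw [← hk N, hx, le_min_iff, ENNReal.le_div_iff_mul_le (by simp) (by simp),
      pow_dvd_iff_le_emultiplicity, pow_dvd_iff_le_emultiplicity]
    rw [← ENat.toENNReal_le (m := ((2 * N : ℕ) : ℕ∞)), ← ENat.toENNReal_le (m := (N : ℕ∞))]
    push_cast
    rw [mul_comm]
  have htop : x ≠ ⊤ := by
    intro h
    have := (hle (k + 1)).1 (by rw [h]; exact le_top)
    omega
  have hle' : ∀ N : ℕ, (N : ℝ) ≤ x.toReal ↔ N ≤ k := by
    intro N
    rw [← hle N, ← ENNReal.toReal_le_toReal (by simp) htop, ENNReal.toReal_natCast]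
  rw [nuExp, ← hx, Nat.floor_eq_iff ENNReal.toReal_nonneg]
  refine ⟨(hle' k).2 le_rfl, ?_⟩
  have := mt (hle' (k + 1)).1 (by omega)
  push_cast at this
  exact not_le.1 this

/-! ### Valuations of the two quadratic discriminants. -/

section Valuations

variable {p : ℕ} [hp : Fact p.Prime] {a b c : ℤ} {l n w : ℤ_[p]}

namespace PadicFactorization

variable (H : PadicFactorization p a b c l n w)
include H

theorem discr_sub : l * ((l ^ 2 - 4 * n) - (l ^ 2 - 4 * w)) = 4 * b := by
  linear_combination 4 * H.diff

theorem discr_add : (l ^ 2 - 4 * n) + (l ^ 2 - 4 * w) = -2 * (l ^ 2 + 2 * a) := by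
  linear_combination (-4 : ℤ_[p]) * H.sum

theorem resolvent : l ^ 4 * (l ^ 2 + 2 * a) = b ^ 2 - ((a : ℤ_[p]) ^ 2 - 4 * c) * l ^ 2 := by
  linear_combination (l * (w - n) + b) * H.diff - l ^ 2 * (n + w + l ^ 2 + a) * H.sum
    + 4 * l ^ 2 * H.prod

/-- The resolvent equation is used to replace l² + 2a by terms in b and a² - 4c; the main term is
the source of A² + 8aB². -/
theorem discr_mul : l ^ 8 * ((l ^ 2 - 4 * n) * (l ^ 2 - 4 * w)) =
    l ^ 4 * (((a : ℤ_[p]) ^ 2 - 4 * c) ^ 2 + 8 * a * b ^ 2)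
      + 2 * ((a : ℤ_[p]) ^ 2 - 4 * c) * b ^ 2 * l ^ 2 - 3 * b ^ 4 := by
  have h1 : (l ^ 2 - 4 * n) * (l ^ 2 - 4 * w) = l ^ 4 - 4 * l ^ 2 * (l ^ 2 + a) + 16 * c := by
    linear_combination (-4 * l ^ 2) * H.sum + 16 * H.prod
  linear_combination l ^ 8 * h1 + (8 * a * l ^ 4 + 2 * ((a : ℤ_[p]) ^ 2 - 4 * c) * l ^ 2
    - 3 * (b ^ 2 + l ^ 4 * (l ^ 2 + 2 * a) + ((a : ℤ_[p]) ^ 2 - 4 * c) * l ^ 2)) * H.resolvent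

/-- As 2 and l are units, the sum and difference of the two discriminants are l² + 2a and b up to
units, and by the resolvent relation l² + 2a may be traded for a² - 4c modulo b. -/
theorem pow_dvd_and_iff (hp2 : 2 < p) (k : ℕ) :
    ((p : ℤ_[p]) ^ k ∣ l ^ 2 - 4 * n ∧ (p : ℤ_[p]) ^ k ∣ l ^ 2 - 4 * w) ↔
      ((p : ℤ) ^ k ∣ b ∧ (p : ℤ) ^ k ∣ a ^ 2 - 4 * c) := by
  have h2 := padicInt_not_dvd_two (p := p) hp2
  have h4 := padicInt_not_dvd_four (p := p) hp2
  have e2 : 2 * (l ^ 2 - 4 * n) = -2 * (l ^ 2 + 2 * a)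
      + ((l ^ 2 - 4 * n) - (l ^ 2 - 4 * w)) := by linear_combination H.discr_add
  have e3 : 2 * (l ^ 2 - 4 * w) = -2 * (l ^ 2 + 2 * a)
      - ((l ^ 2 - 4 * n) - (l ^ 2 - 4 * w)) := by linear_combination H.discr_add
  rw [← PadicInt.pow_p_dvd_int_iff, ← PadicInt.pow_p_dvd_int_iff]
  push_cast
  constructor
  · rintro ⟨h, h'⟩
    have hb : (p : ℤ_[p]) ^ k ∣ b := by
      rw [← padicInt_pow_dvd_mul_left h4, ← H.discr_sub]
      exact (dvd_sub h h').mul_left _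
    refine ⟨hb, ?_⟩
    have hs : (p : ℤ_[p]) ^ k ∣ l ^ 2 + 2 * a := by
      rw [← padicInt_pow_dvd_mul_left h2, ← dvd_neg, ← neg_mul, ← H.discr_add]
      exact dvd_add h h'
    rw [← padicInt_pow_dvd_mul_right (padicInt_not_dvd_pow H.unit 2)]
    have e : ((a : ℤ_[p]) ^ 2 - 4 * c) * l ^ 2 = b * b - (l ^ 2 + 2 * a) * l ^ 4 := by
      linear_combination H.resolvent
    rw [e]
    exact dvd_sub (hb.mul_right _) (hs.mul_right _)
  · rintro ⟨hb, hD⟩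
    have hs : (p : ℤ_[p]) ^ k ∣ l ^ 2 + 2 * a := by
      rw [← padicInt_pow_dvd_mul_left (padicInt_not_dvd_pow H.unit 4), H.resolvent]
      exact dvd_sub (hb.trans (dvd_pow_self _ two_ne_zero)) (hD.mul_right _)
    have hd : (p : ℤ_[p]) ^ k ∣ (l ^ 2 - 4 * n) - (l ^ 2 - 4 * w) := by
      rw [← padicInt_pow_dvd_mul_left H.unit, H.discr_sub]
      exact hb.mul_left _
    constructor
    · rw [← padicInt_pow_dvd_mul_left h2, e2]
      exact dvd_add (hs.mul_left _) hd
    · rw [← padicInt_pow_dvd_mul_left h2, e3]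
      exact dvd_sub (hs.mul_left _) hd

theorem pow_dvd_center (k : ℕ) (hb : (p : ℤ) ^ k ∣ b ^ 2) (hD : (p : ℤ) ^ k ∣ a ^ 2 - 4 * c) :
    (p : ℤ_[p]) ^ k ∣ l ^ 2 + 2 * a := by
  rw [← PadicInt.pow_p_dvd_int_iff] at hb hD
  push_cast at hb hD
  rw [← padicInt_pow_dvd_mul_left (padicInt_not_dvd_pow H.unit 4), H.resolvent]
  exact dvd_sub hb (hD.mul_right _)

theorem pow_dvd_of_approx (hp2 : 2 < p) {s : ℤ} (hs : (p : ℤ_[p]) ∣ 2 * s + l) {k : ℕ}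
    (hk : (p : ℤ) ^ k ∣ 2 * s ^ 2 + a) (hb : (p : ℤ) ^ k ∣ b) (hD : (p : ℤ) ^ k ∣ a ^ 2 - 4 * c) :
    (p : ℤ_[p]) ^ k ∣ 2 * s + l := by
  have hU : ¬ (p : ℤ_[p]) ∣ 2 * s - l := by
    intro h
    have h3 := dvd_sub hs h
    have e3 : 2 * (s : ℤ_[p]) + l - (2 * s - l) = 2 * l := by ring
    rw [e3] at h3
    exact padicInt_not_dvd_mul (padicInt_not_dvd_two hp2) H.unit h3
  have hc := H.pow_dvd_center k (hb.trans (dvd_pow_self _ two_ne_zero)) hD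
  rw [← PadicInt.pow_p_dvd_int_iff] at hk
  push_cast at hk
  rw [← padicInt_pow_dvd_mul_right hU]
  have e : (2 * (s : ℤ_[p]) + l) * (2 * s - l) = 2 * (2 * s ^ 2 + a) - (l ^ 2 + 2 * a) := by ring
  rw [e]
  exact dvd_sub (hk.mul_left _) hc

theorem discr_eq : ((depressedQuartic a b c).discr : ℤ_[p])
    = (l ^ 2 - 4 * n) * (l ^ 2 - 4 * w) * ((n - w) ^ 2 + 2 * l ^ 2 * (n + w)) ^ 2 := by
  rw [← discr_intCast _ (depressedQuartic_monic a b c) (by rw [depressedQuartic_natDegree]; norm_num),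
    depressedQuartic_map]
  exact discr_depressedQuartic (by simpa using H.sum) (by simpa using H.diff)
    (by simpa using H.prod)

theorem not_dvd_resultant (hp2 : 2 < p) :
    ¬ (p : ℤ_[p]) ∣ (n - w) ^ 2 + 2 * l ^ 2 * (n + w) := by
  intro h
  have h4 := padicInt_not_dvd_four (p := p) hp2
  have e : 4 * ((n - w) ^ 2 + 2 * l ^ 2 * (n + w)) = (l ^ 2 - 4 * n) * (w - n - 2 * l ^ 2)
      + (l ^ 2 - 4 * w) * (n - w - 2 * l ^ 2) + 4 * (l ^ 2) ^ 2 := by ring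
  have h1 := h.mul_left 4
  rw [e, dvd_add_right (dvd_add (H.left_dvd.mul_right _) (H.right_dvd.mul_right _))] at h1
  exact padicInt_not_dvd_mul h4 (padicInt_not_dvd_pow (padicInt_not_dvd_pow H.unit 2) 2) h1

end PadicFactorization

/-- The exponents of `p` in `b` and `a² - 4c`. -/
structure ExactPowers (p : ℕ) (a b c A B : ℤ) (m m' : ℕ) : Prop where
  hB : ¬ (p : ℤ) ∣ B
  hA : ¬ (p : ℤ) ∣ A
  hb : b = B * (p : ℤ) ^ m
  hac : a ^ 2 - 4 * c = A * (p : ℤ) ^ m'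

namespace ExactPowers

variable {A B : ℤ} {m m' : ℕ} (E : ExactPowers p a b c A B m m')
include E

theorem pow_dvd_b (k : ℕ) : (p : ℤ) ^ k ∣ b ↔ k ≤ m := by
  have hP := Nat.prime_iff_prime_int.1 hp.out
  constructor
  · intro h
    by_contra hcon
    have h1 := (pow_dvd_pow (p : ℤ) (by omega : m + 1 ≤ k)).trans h
    rw [E.hb, mul_comm, pow_succ, mul_dvd_mul_iff_left (pow_ne_zero _ hP.ne_zero)] at h1
    exact E.hB h1
  · intro h
    rw [E.hb]
    exact (pow_dvd_pow _ h).mul_left _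

theorem pow_dvd_D (k : ℕ) : (p : ℤ) ^ k ∣ a ^ 2 - 4 * c ↔ k ≤ m' := by
  have hP := Nat.prime_iff_prime_int.1 hp.out
  constructor
  · intro h
    by_contra hcon
    have h1 := (pow_dvd_pow (p : ℤ) (by omega : m' + 1 ≤ k)).trans h
    rw [E.hac, mul_comm, pow_succ, mul_dvd_mul_iff_left (pow_ne_zero _ hP.ne_zero)] at h1
    exact E.hA h1
  · intro h
    rw [E.hac]
    exact (pow_dvd_pow _ h).mul_left _

/-- Suppose p^(2r+1) divides d = l² - 4n, and let d' = l² - 4w. If m < m' then p^(r+1) divides d +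
d', and if m > m' it divides d - d'; either way it divides both, contradicting min(v(d), v(d')) = r.
If m = m', the product formula makes p^(r+1) divide (A² + 8aB²)l⁴ + p^r·(unit), so δ = r. -/
theorem not_pow_dvd_discr (hp2 : 2 < p) (H : PadicFactorization p a b c l n w) {r : ℕ}
    (hr : r = min m m') (hr0 : 0 < r)
    (hδ : m ≠ m' ∨ (r : ℕ∞) ≠ emultiplicity (p : ℤ) (A ^ 2 + 8 * a * B ^ 2)) :
    ¬ (p : ℤ_[p]) ^ (2 * r + 1) ∣ l ^ 2 - 4 * n := by
  intro hd
  have hd' : (p : ℤ_[p]) ^ (r + 1) ∣ l ^ 2 - 4 * n := (pow_dvd_pow _ (by omega)).trans hd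
  have hboth := H.pow_dvd_and_iff hp2 (r + 1)
  rw [E.pow_dvd_b, E.pow_dvd_D] at hboth
  have hnot : ¬ (p : ℤ_[p]) ^ (r + 1) ∣ l ^ 2 - 4 * w := fun h => by
    have := hboth.1 ⟨hd', h⟩
    omega
  rcases lt_trichotomy m m' with hm | hm | hm
  · apply hnot
    have h2 := H.pow_dvd_center (r + 1) (by
      have := (E.pow_dvd_b r).2 (by omega)
      refine (pow_dvd_pow _ (by omega : r + 1 ≤ r * 2)).trans ?_
      rw [pow_mul]
      exact pow_dvd_pow_of_dvd this 2) ((E.pow_dvd_D _).2 (by omega))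
    have e : l ^ 2 - 4 * w = -2 * (l ^ 2 + 2 * a) - (l ^ 2 - 4 * n) := by
      linear_combination H.discr_add
    rw [e]
    exact dvd_sub (h2.mul_left _) hd'
  · obtain rfl : m = r := by omega
    subst hm
    replace hδ : (m : ℕ∞) ≠ emultiplicity (p : ℤ) (A ^ 2 + 8 * a * B ^ 2) := by simpa using hδ
    have hdw := ((H.pow_dvd_and_iff hp2 m).2
      ⟨(E.pow_dvd_b m).2 le_rfl, (E.pow_dvd_D m).2 le_rfl⟩).2
    have h3 := (mul_dvd_mul hd hdw).mul_left (l ^ 8)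
    have hac : (a : ℤ_[p]) ^ 2 - 4 * c = A * (p : ℤ_[p]) ^ m := by
      have := congrArg (Int.cast : ℤ → ℤ_[p]) E.hac
      push_cast at this
      exact this
    have hb : (b : ℤ_[p]) = B * (p : ℤ_[p]) ^ m := by
      have := congrArg (Int.cast : ℤ → ℤ_[p]) E.hb
      push_cast at this
      exact this
    have hp0 : (p : ℤ_[p]) ≠ 0 := PadicInt.prime_p.ne_zero
    rw [H.discr_mul, hac, hb] at h3
    have e : l ^ 4 * ((A * (p : ℤ_[p]) ^ m) ^ 2 + 8 * a * (B * p ^ m) ^ 2)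
        + 2 * (A * p ^ m) * (B * p ^ m) ^ 2 * l ^ 2 - 3 * (B * p ^ m) ^ 4
        = p ^ (2 * m) * ((A ^ 2 + 8 * a * B ^ 2) * l ^ 4 +
          (2 * A * B ^ 2 * l ^ 2 - 3 * B ^ 4 * p ^ m) * p ^ m) := by ring
    have e' : (p : ℤ_[p]) ^ (2 * m + 1) * p ^ m = p ^ (2 * m) * p ^ (m + 1) := by ring
    rw [e, e', mul_dvd_mul_iff_left (pow_ne_zero _ hp0)] at h3
    apply hδ
    symm
    have hu : ¬ (p : ℤ_[p]) ∣ 2 * A * B ^ 2 * l ^ 2 - 3 * B ^ 4 * p ^ m := by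
      have hm0 : (p : ℤ_[p]) ∣ 3 * B ^ 4 * p ^ m := (dvd_pow_self _ (by omega)).mul_left _
      rw [dvd_sub_left hm0]
      have hA := E.hA
      have hB := E.hB
      rw [← padicInt_dvd_intCast_iff (p := p)] at hA hB
      exact padicInt_not_dvd_mul (padicInt_not_dvd_mul (padicInt_not_dvd_mul
        (padicInt_not_dvd_two hp2) hA) (padicInt_not_dvd_pow hB 2)) (padicInt_not_dvd_pow H.unit 2)
    rw [emultiplicity_eq_coe, ← PadicInt.pow_p_dvd_int_iff, ← PadicInt.pow_p_dvd_int_iff]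
    push_cast
    have hl := padicInt_not_dvd_pow H.unit 4
    constructor
    · have h4 := (pow_dvd_pow (p : ℤ_[p]) (by omega : m ≤ m + 1)).trans h3
      rw [dvd_add_left (Dvd.intro_left _ rfl), padicInt_pow_dvd_mul_right hl] at h4
      exact h4
    · intro hcon
      rw [dvd_add_right (hcon.mul_right _), padicInt_pow_dvd_mul_left hu,
        pow_dvd_pow_iff hp0 PadicInt.prime_p.not_isUnit] at h3
      omega
  · apply hnot
    have hb := (E.pow_dvd_b (r + 1)).2 (by omega)
    rw [← PadicInt.pow_p_dvd_int_iff] at hb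
    have h2 := hb.mul_left 4
    rw [← H.discr_sub, padicInt_pow_dvd_mul_left H.unit, dvd_sub_right hd'] at h2
    exact h2

end ExactPowers

end Valuations

/-! ### Integrality of the last two basis elements. -/

section Integrality

theorem isIntegral_of_sq_eq {R A : Type*} [CommRing R] [CommRing A] [Algebra R A] {z u v : A}
    (hu : IsIntegral R u) (hv : IsIntegral R v) (h : z ^ 2 = u * z + v) : IsIntegral R z := by
  let u' : integralClosure R A := ⟨u, hu⟩
  let v' : integralClosure R A := ⟨v, hv⟩
  refine isIntegral_trans (A := integralClosure R A) z ⟨X ^ 2 - (C u' * X + C v'), ?_, ?_⟩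
  · monicity!
  · rw [eval₂_sub, eval₂_add, eval₂_mul, eval₂_pow, eval₂_X, eval₂_C, eval₂_C, h]
    exact sub_self _

variable {K : Type*} [Field K] [CharZero K] {a b c : ℤ} {θ : K} {p : ℕ} [hp : Fact p.Prime]

theorem isIntegral_quadratic_div (hθ : θ ^ 4 + a * θ ^ 2 + b * θ + c = 0) {s : ℤ} {k : ℕ}
    (hb : (p : ℤ) ^ (2 * k) ∣ b) (hf : (p : ℤ) ^ (2 * k) ∣ (depressedQuartic a b c).eval s)
    (hg : (p : ℤ) ^ k ∣ 2 * s ^ 2 + a) (hθi : IsIntegral ℤ θ) :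
    IsIntegral ℤ ((θ ^ 2 + (s : K) ^ 2 + (a : K)) / (p : K) ^ k) := by
  have hp0 : (p : K) ≠ 0 := by exact_mod_cast hp.out.ne_zero
  rw [depressedQuartic_eval] at hf
  obtain ⟨b', hb'⟩ := hb
  obtain ⟨f', hf'⟩ := hf
  obtain ⟨g', hg'⟩ := hg
  refine isIntegral_of_sq_eq (isIntegral_intCast g')
    (v := -((b' : K) * θ) - ((f' - b' * s : ℤ) : K))
    (((isIntegral_intCast _).mul hθi).neg.sub (isIntegral_intCast _)) ?_
  have hb'' := congrArg (Int.cast : ℤ → K) hb'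
  have hf'' := congrArg (Int.cast : ℤ → K) hf'
  have hg'' := congrArg (Int.cast : ℤ → K) hg'
  push_cast at hb'' hf'' hg'' ⊢
  -- With z = θ² + s² + a, the product z(θ² - s²) equals -bθ - (f(s) - bs), and θ² - s² = z - (2s² +
  -- a).
  have e : (θ ^ 2 + (s : K) ^ 2 + a) ^ 2 = (p : K) ^ k * g' * (θ ^ 2 + (s : K) ^ 2 + a)
      + (-((p : K) ^ (2 * k) * b' * θ) - ((p : K) ^ (2 * k) * f' - (p : K) ^ (2 * k) * b' * s)) := by
    rw [← hb'', ← hf'', ← hg'']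
    linear_combination hθ
  rw [div_pow, e]
  field_simp
  ring

theorem isIntegral_cubic_div (hθ : θ ^ 4 + a * θ ^ 2 + b * θ + c = 0) {s : ℤ} {k : ℕ}
    (hf : (p : ℤ) ^ (2 * k) ∣ (depressedQuartic a b c).eval s)
    (hf' : (p : ℤ) ^ k ∣ (derivative (depressedQuartic a b c)).eval s) (hθi : IsIntegral ℤ θ) :
    IsIntegral ℤ ((θ ^ 3 + (s : K) * θ ^ 2 + ((a : K) + (s : K) ^ 2) * θ + (s : K) ^ 3
            + (a : K) * (s : K) + (b : K)) / (p : K) ^ k) := by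
  have hp0 : (p : K) ≠ 0 := by exact_mod_cast hp.out.ne_zero
  rw [depressedQuartic_eval] at hf
  rw [depressedQuartic_derivative_eval] at hf'
  obtain ⟨x, hx⟩ := hf
  obtain ⟨y, hy⟩ := hf'
  have hi : IsIntegral ℤ (θ ^ 2 + (2 * s : ℤ) * θ + (3 * s ^ 2 + a : ℤ) : K) :=
    ((hθi.pow 2).add ((isIntegral_intCast _).mul hθi)).add (isIntegral_intCast _)
  refine isIntegral_of_sq_eq (isIntegral_intCast y)
    (hi.mul (isIntegral_intCast x)).neg ?_
  have hx' := congrArg (Int.cast : ℤ → K) hx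
  have hy' := congrArg (Int.cast : ℤ → K) hy
  push_cast at hx' hy' ⊢
  -- The cubic z is the value at θ of (f(X) - f(s))/(X - s), so (θ - s)z = -f(s). Dividing once
  -- more, z = f'(s) + (θ - s)q with q = θ² + 2sθ + 3s² + a; multiplying by z gives z² = f'(s)z -
  -- f(s)q.
  have e : (θ ^ 3 + (s : K) * θ ^ 2 + ((a : K) + (s : K) ^ 2) * θ + (s : K) ^ 3
            + (a : K) * (s : K) + (b : K)) ^ 2 = (p : K) ^ k * y *
      (θ ^ 3 + (s : K) * θ ^ 2 + ((a : K) + (s : K) ^ 2) * θ + (s : K) ^ 3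
            + (a : K) * (s : K) + (b : K))
      - (θ ^ 2 + 2 * s * θ + (3 * s ^ 2 + a)) * ((p : K) ^ (2 * k) * x) := by
    rw [← hx', ← hy']
    linear_combination (θ ^ 2 + 2 * s * θ + (3 * s ^ 2 + a)) * hθ
  rw [div_pow, e]
  field_simp
  ring

end Integrality

/-! ### Membership in the ring of p-adic integers. -/

section PadicMembership

variable {p : ℕ} [hp : Fact p.Prime]

theorem coe_mem_padicSubring (x : ℤ_[p]) : (x : ℚ_[p]) ∈ PadicInt.subring p := x.2

theorem mem_padicSubring_of_isIntegral {x : ℚ_[p]} (hx : IsIntegral ℤ x) :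
    x ∈ PadicInt.subring p := by
  obtain ⟨y, rfl⟩ := (IsIntegrallyClosed.isIntegral_iff (R := ℤ_[p])).1 (hx.tower_top (A := ℤ_[p]))
  exact y.2

theorem mem_padicSubring_of_mul {u : ℤ_[p]} {x : ℚ_[p]} (hu : ¬ (p : ℤ_[p]) ∣ u)
    (h : (u : ℚ_[p]) * x ∈ PadicInt.subring p) : x ∈ PadicInt.subring p := by
  have h1 := PadicInt.isUnit_iff.1 (padicInt_isUnit_of_not_dvd hu)
  rw [PadicInt.mem_subring_iff, norm_mul, PadicInt.padic_norm_e_of_padicInt, h1, one_mul] at h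
  exact h

/-- Here v(d) ≤ 2k + 1, so v² has valuation at least -(2k + 1); by parity v has valuation at least
-k. -/
theorem pow_mul_mem_padicSubring {d : ℤ_[p]} {v : ℚ_[p]} {k : ℕ}
    (hd : ¬ (p : ℤ_[p]) ^ (2 * k + 2) ∣ d) (h : v ^ 2 * d ∈ PadicInt.subring p) :
    (p : ℚ_[p]) ^ k * v ∈ PadicInt.subring p := by
  have hp0 : (p : ℚ_[p]) ≠ 0 := by exact_mod_cast hp.out.ne_zero
  by_contra hcon
  rw [PadicInt.mem_subring_iff, not_le] at hcon
  set z := (p : ℚ_[p]) ^ k * v with hz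
  have hz0 : z ≠ 0 := fun h0 => by
    rw [h0, norm_zero] at hcon
    linarith
  have hlt : ‖z⁻¹‖ < 1 := by
    rw [norm_inv]
    exact inv_lt_one_of_one_lt₀ hcon
  obtain ⟨y, hy⟩ := (PadicInt.norm_lt_one_iff_dvd (⟨z⁻¹, hlt.le⟩ : ℤ_[p])).1 hlt
  have hy' : z⁻¹ = p * y := congrArg (Subtype.val : ℤ_[p] → ℚ_[p]) hy
  apply hd
  obtain ⟨e, he⟩ : ∃ e : ℤ_[p], (e : ℚ_[p]) = v ^ 2 * d := ⟨⟨_, h⟩, rfl⟩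
  refine ⟨e * y ^ 2, ?_⟩
  apply PadicInt.ext
  push_cast
  rw [he]
  have h1 : z * (p * y) = 1 := by rw [← hy', mul_inv_cancel₀ hz0]
  have h2 : (z * (p * y)) ^ 2 = 1 := by rw [h1, one_pow]
  rw [hz] at h2
  linear_combination -(d : ℚ_[p]) * h2

theorem exists_int_mul_of_mem_padicSubring {q : ℚ} (h : (q : ℚ_[p]) ∈ PadicInt.subring p) :
    ∃ d e : ℤ, ¬ (p : ℤ) ∣ d ∧ (d : ℚ) * q = e := by
  refine ⟨q.den, q.num, ?_, ?_⟩
  · have h1 := PadicInt.isUnit_den q h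
    rw [← padicInt_dvd_intCast_iff (p := p)]
    intro hd
    exact PadicInt.prime_p.not_isUnit (isUnit_of_dvd_unit hd (by simpa using h1))
  · push_cast
    rw [mul_comm]
    exact Rat.mul_den_eq_num q

end PadicMembership

/-! ### Coordinates in K and transport of integrality to conjugates. -/

section Field

variable {K : Type*} [Field K] [NumberField K] {θ : K} {a b c : ℤ}

theorem minpoly_eq_depressedQuartic (hirr : Irreducible (depressedQuartic a b c))
    (hθ : aeval θ (depressedQuartic a b c) = 0) :
    minpoly ℚ θ = (depressedQuartic a b c).map (Int.castRingHom ℚ) := by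
  have hm := depressedQuartic_monic a b c
  refine (minpoly.eq_of_irreducible_of_monic
    ((IsPrimitive.Int.irreducible_iff_irreducible_map_cast hm.isPrimitive).1 hirr) ?_
    (hm.map _)).symm
  rw [← hθ]
  exact aeval_map_algebraMap ℚ θ _

theorem eval₂_aeval_eq_aeval_comp {M : Type*} [Field M] [Algebra ℚ M] (h : ℤ[X]) (P : ℚ[X]) (x : M) :
    eval₂ (algebraMap ℤ M) (aeval x P) h = aeval x ((h.map (Int.castRingHom ℚ)).comp P) := by
  rw [aeval_comp]
  exact (aeval_map_algebraMap ℚ (aeval x P) h).symm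

/-- Rational expressions in `θ` which are integral are also integral at the conjugates of `θ`. -/
theorem isIntegral_aeval_conjugate (hirr : Irreducible (depressedQuartic a b c))
    (hθ : aeval θ (depressedQuartic a b c) = 0) {L : Type*} [Field L] [Algebra ℚ L] {α : L}
    (hα : aeval α (depressedQuartic a b c) = 0) (P : ℚ[X]) (hP : IsIntegral ℤ (aeval θ P)) :
    IsIntegral ℤ (aeval α P) := by
  obtain ⟨h, hm, h0⟩ := hP
  refine ⟨h, hm, ?_⟩
  rw [eval₂_aeval_eq_aeval_comp] at h0 ⊢
  -- The composite h ∘ P kills θ, so it is a multiple of f and kills every root of f.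
  obtain ⟨Q, hQ⟩ := minpoly.dvd ℚ θ h0
  rw [hQ, map_mul, minpoly_eq_depressedQuartic hirr hθ]
  have : aeval α ((depressedQuartic a b c).map (Int.castRingHom ℚ)) = 0 := by
    rw [← hα]
    exact aeval_map_algebraMap ℚ α _
  rw [this, zero_mul]

theorem exists_coefficients (hirr : Irreducible (depressedQuartic a b c))
    (hθ : aeval θ (depressedQuartic a b c) = 0)
    (hK : IntermediateField.adjoin ℚ {θ} = ⊤) (x : K) :
    ∃ c₀ c₁ c₂ c₃ : ℚ, x = c₀ + c₁ * θ + c₂ * θ ^ 2 + c₃ * θ ^ 3 := by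
  have hθi : IsIntegral ℚ θ := Algebra.IsIntegral.isIntegral θ
  have hx : x ∈ Algebra.adjoin ℚ {θ} := by
    rw [← IntermediateField.adjoin_simple_toSubalgebra_of_isAlgebraic hθi.isAlgebraic, hK]
    exact Subalgebra.mem_carrier.1 trivial
  rw [Algebra.adjoin_singleton_eq_range_aeval] at hx
  obtain ⟨Q, rfl⟩ := hx
  have hmp := minpoly_eq_depressedQuartic hirr hθ
  have hmon := minpoly.monic hθi
  have hdeg : (minpoly ℚ θ).natDegree = 4 := by
    rw [hmp, (depressedQuartic_monic a b c).natDegree_map, depressedQuartic_natDegree]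
  have hlt : (Q %ₘ minpoly ℚ θ).natDegree < 4 := by
    rw [← hdeg]
    exact natDegree_modByMonic_lt _ hmon (minpoly.ne_one ℚ θ)
  have e : aeval θ Q = aeval θ (Q %ₘ minpoly ℚ θ) :=
    (aeval_modByMonic_eq_self_of_root (minpoly.aeval ℚ θ)).symm
  refine ⟨(Q %ₘ minpoly ℚ θ).coeff 0, (Q %ₘ minpoly ℚ θ).coeff 1, (Q %ₘ minpoly ℚ θ).coeff 2,
    (Q %ₘ minpoly ℚ θ).coeff 3, ?_⟩
  change aeval θ Q = _
  rw [e, aeval_eq_sum_range' hlt]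
  simp [Finset.sum_range_succ, Algebra.smul_def]

theorem coefficients_eq_zero (hirr : Irreducible (depressedQuartic a b c))
    (hθ : aeval θ (depressedQuartic a b c) = 0) {c₀ c₁ c₂ c₃ : ℚ}
    (h : (c₀ + c₁ * θ + c₂ * θ ^ 2 + c₃ * θ ^ 3 : K) = 0) :
    c₀ = 0 ∧ c₁ = 0 ∧ c₂ = 0 ∧ c₃ = 0 := by
  let P : ℚ[X] := C c₀ + C c₁ * X + C c₂ * X ^ 2 + C c₃ * X ^ 3
  have hP : aeval θ P = 0 := by
    rw [← h]
    simp [P]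
  have hdeg : (minpoly ℚ θ).natDegree = 4 := by
    rw [minpoly_eq_depressedQuartic hirr hθ, (depressedQuartic_monic a b c).natDegree_map,
      depressedQuartic_natDegree]
  have hPd : P.natDegree ≤ 3 := by
    simp only [P]
    compute_degree
  have h0 : P = 0 := by
    by_contra hne
    have := natDegree_le_of_dvd (minpoly.dvd ℚ θ hP) hne
    omega
  have hc : ∀ i, P.coeff i = 0 := fun i => by rw [h0, coeff_zero]
  have h0 := hc 0
  have h1 := hc 1
  have h2 := hc 2
  have h3 := hc 3
  simp only [P, coeff_add, coeff_C_mul, coeff_X, coeff_C, coeff_X_pow] at h0 h1 h2 h3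
  norm_num at h0 h1 h2 h3
  exact ⟨h0, h1, h2, h3⟩

end Field

/-! ### Denominators of integral elements and the p-integral basis. -/

section Basis

theorem padicInt_coe_two {p : ℕ} [Fact p.Prime] : ((2 : ℤ_[p]) : ℚ_[p]) = 2 := rfl

theorem padicInt_coe_four {p : ℕ} [Fact p.Prime] : ((4 : ℤ_[p]) : ℚ_[p]) = 4 := rfl

variable {p : ℕ} [hp : Fact p.Prime] {a b c : ℤ} {l n w : ℤ_[p]}
  {K : Type*} [Field K] [NumberField K] {θ : K}

namespace PadicFactorization

/-- The reduction `u + v X` of a rational expression modulo the factor `X² + l X + n`: if the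
expression is integral, then so are its trace and the square of the difference of its conjugates. -/
theorem mem_of_isIntegral (H : PadicFactorization p a b c l n w)
    (hirr : Irreducible (depressedQuartic a b c))
    (hθ : aeval θ (depressedQuartic a b c) = 0) {c₀ c₁ c₂ c₃ : ℚ}
    (hx : IsIntegral ℤ (c₀ + c₁ * θ + c₂ * θ ^ 2 + c₃ * θ ^ 3 : K)) :
    (2 * (c₃ * (l * n) - n * c₂ + c₀) - l * (c₃ * (l ^ 2 - n) - l * c₂ + c₁) : ℚ_[p])
        ∈ PadicInt.subring p ∧
      (c₃ * (l ^ 2 - n) - l * c₂ + c₁ : ℚ_[p]) ^ 2 * (l ^ 2 - 4 * n : ℤ_[p])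
        ∈ PadicInt.subring p := by
  let L := AlgebraicClosure ℚ_[p]
  let φ := algebraMap ℚ_[p] L
  let P : ℚ[X] := C c₀ + C c₁ * X + C c₂ * X ^ 2 + C c₃ * X ^ 3
  have hP : IsIntegral ℤ (aeval θ P) := by simpa [P] using hx
  obtain ⟨α, hα⟩ : ∃ α : L, α ^ 2 + φ l * α + φ n = 0 := by
    obtain ⟨α, hα⟩ := IsAlgClosed.exists_root (monicQuadratic (φ l) (φ n)) (by
      rw [degree_eq_natDegree (monicQuadratic_monic _ _).ne_zero, monicQuadratic_natDegree]
      norm_num)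
    exact ⟨α, by simpa [monicQuadratic] using hα⟩
  have hsum := congrArg (fun x : ℤ_[p] => φ x) H.sum
  have hdiff := congrArg (fun x : ℤ_[p] => φ x) H.diff
  have hprod := congrArg (fun x : ℤ_[p] => φ x) H.prod
  push_cast at hsum hdiff hprod
  simp only [map_add, map_mul, map_sub, map_pow, map_intCast] at hsum hdiff hprod
  have hroot : ∀ β : L, β ^ 2 + φ l * β + φ n = 0 →
      IsIntegral ℤ (φ (c₃ * (l * n) - n * c₂ + c₀) + φ (c₃ * (l ^ 2 - n) - l * c₂ + c₁) * β) := by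
    intro β hβ
    have h0 : aeval β (depressedQuartic a b c) = 0 := by
      simp only [depressedQuartic, map_add, map_mul, map_pow, aeval_X, eq_intCast, map_intCast]
      linear_combination (β ^ 2 - φ l * β + φ w) * hβ - β ^ 2 * hsum - β * hdiff - hprod
    have h1 := isIntegral_aeval_conjugate hirr hθ h0 P hP
    have e : aeval β P
        = φ (c₃ * (l * n) - n * c₂ + c₀) + φ (c₃ * (l ^ 2 - n) - l * c₂ + c₁) * β := by
      simp only [P, map_add, map_mul, map_sub, map_pow, aeval_X, aeval_C, eq_ratCast, map_ratCast]
      linear_combination (c₂ + c₃ * (β - φ l)) * hβ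
    rwa [e] at h1
  have h1 := hroot α hα
  -- The second root of the factor; the sum of the two values is the trace, and their difference
  -- squared is v²(2α + l)² = v²(l² - 4n).
  have h2 := hroot (-φ l - α) (by linear_combination hα)
  have hinj : Function.Injective φ := (algebraMap ℚ_[p] L).injective
  constructor
  · apply mem_padicSubring_of_isIntegral
    rw [← isIntegral_algebraMap_iff hinj]
    refine (congrArg (IsIntegral ℤ) ?_).mpr (h1.add h2)
    change φ _ = _
    simp only [map_add, map_mul, map_sub, map_pow, map_ratCast, map_ofNat]
    ring
  · apply mem_padicSubring_of_isIntegral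
    rw [← isIntegral_algebraMap_iff hinj]
    refine (congrArg (IsIntegral ℤ) ?_).mpr ((h1.sub h2).pow 2)
    change φ _ = _
    push_cast
    rw [padicInt_coe_four]
    simp only [map_add, map_mul, map_sub, map_pow, map_ratCast, map_ofNat]
    linear_combination (-4 * (c₃ * (φ l ^ 2 - φ n) - φ l * c₂ + c₁) ^ 2) * hα

variable {k k' : ℕ} {c₀ c₁ c₂ c₃ : ℚ} (H : PadicFactorization p a b c l n w)
  (hirr : Irreducible (depressedQuartic a b c))
  (hθ : aeval θ (depressedQuartic a b c) = 0) (hp2 : 2 < p)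
  (hd : ¬ (p : ℤ_[p]) ^ (2 * k' + 2) ∣ l ^ 2 - 4 * n)
  (hd' : ¬ (p : ℤ_[p]) ^ (2 * k + 2) ∣ l ^ 2 - 4 * w)
  (hx : IsIntegral ℤ (c₀ + c₁ * θ + c₂ * θ ^ 2 + c₃ * θ ^ 3 : K))
include H hirr hθ hx

/-- Bounds for the coefficients of an integral element, in terms of the reductions modulo
the two factors. -/
theorem reductions_mem (hd : ¬ (p : ℤ_[p]) ^ (2 * k' + 2) ∣ l ^ 2 - 4 * n)
    (hd' : ¬ (p : ℤ_[p]) ^ (2 * k + 2) ∣ l ^ 2 - 4 * w) :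
    (2 * (c₃ * (l * n) - n * c₂ + c₀) - l * (c₃ * (l ^ 2 - n) - l * c₂ + c₁) : ℚ_[p])
        ∈ PadicInt.subring p ∧
    (2 * (-(c₃ * (l * w)) - w * c₂ + c₀) + l * (c₃ * (l ^ 2 - w) + l * c₂ + c₁) : ℚ_[p])
        ∈ PadicInt.subring p ∧
    (p : ℚ_[p]) ^ k' * (c₃ * (l ^ 2 - n) - l * c₂ + c₁) ∈ PadicInt.subring p ∧
    (p : ℚ_[p]) ^ k * (c₃ * (l ^ 2 - w) + l * c₂ + c₁) ∈ PadicInt.subring p := by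
  obtain ⟨h1, h2⟩ := H.mem_of_isIntegral hirr hθ hx
  obtain ⟨h3, h4⟩ := H.symm.mem_of_isIntegral hirr hθ hx
  push_cast at h3
  refine ⟨h1, ?_, pow_mul_mem_padicSubring hd h2, ?_⟩
  · convert h3 using 1
    ring
  · have := pow_mul_mem_padicSubring (k := k) (by rwa [neg_sq]) h4
    push_cast at this
    convert this using 1
    ring

include hp2 hd hd'

/-- Eliminating the other coefficients from the two reductions leaves c₃ times the resultant of the
factors, a unit. The assumption k ≤ k' gives both slopes the common denominator p^k'. -/
theorem coeff_three_mem (hk : k ≤ k') : (p : ℚ_[p]) ^ k' * c₃ ∈ PadicInt.subring p := by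
  obtain ⟨h1, h2, h3, h4⟩ := H.reductions_mem hirr hθ hx hd hd'
  have hpk : (p : ℚ_[p]) ^ k' ∈ PadicInt.subring p := by
    simpa using coe_mem_padicSubring ((p : ℤ_[p]) ^ k')
  have hpk' : (p : ℚ_[p]) ^ (k' - k) ∈ PadicInt.subring p := by
    simpa using coe_mem_padicSubring ((p : ℤ_[p]) ^ (k' - k))
  have h5 := mul_mem hpk' h4
  rw [← mul_assoc, ← pow_add, Nat.sub_add_cancel hk] at h5
  have hl := coe_mem_padicSubring l
  have hn := coe_mem_padicSubring n
  have hw := coe_mem_padicSubring w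
  refine mem_padicSubring_of_mul (H.not_dvd_resultant hp2) ?_
  have := sub_mem (mul_mem (sub_mem hn hw) (sub_mem h5 h3))
    (mul_mem hl (sub_mem (mul_mem hpk (sub_mem h2 h1)) (mul_mem hl (add_mem h3 h5))))
  convert this using 1
  push_cast
  rw [padicInt_coe_two]
  ring

/-- When c₃ = 0 only the slope modulo X² - lX + w is needed, hence the smaller exponent k. -/
theorem coeff_two_mem (h0 : c₃ = 0) : (p : ℚ_[p]) ^ k * c₂ ∈ PadicInt.subring p := by
  obtain ⟨h1, h2, h3, h4⟩ := H.reductions_mem hirr hθ hx hd hd'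
  have hpk : (p : ℚ_[p]) ^ k ∈ PadicInt.subring p := by
    simpa using coe_mem_padicSubring ((p : ℤ_[p]) ^ k)
  have hl := coe_mem_padicSubring l
  have hu : ¬ (p : ℤ_[p]) ∣ 2 * (l ^ 2 - (n - w)) := by
    refine padicInt_not_dvd_mul (padicInt_not_dvd_two hp2) fun h => ?_
    have hnw : (p : ℤ_[p]) ∣ n - w := by
      have := dvd_sub H.right_dvd H.left_dvd
      have e : l ^ 2 - 4 * w - (l ^ 2 - 4 * n) = 4 * (n - w) := by ring
      rw [e] at this
      exact (PadicInt.prime_p.dvd_or_dvd this).resolve_left (padicInt_not_dvd_four hp2)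
    rw [dvd_sub_left hnw] at h
    exact padicInt_not_dvd_pow H.unit 2 h
  refine mem_padicSubring_of_mul hu ?_
  have := sub_mem (mul_mem (add_mem hl hl) h4) (mul_mem hpk (sub_mem h2 h1))
  convert this using 1
  push_cast
  rw [h0, padicInt_coe_two]
  push_cast
  ring

theorem coeff_one_zero_mem (h0 : c₃ = 0) (h0' : c₂ = 0) :
    (c₁ : ℚ_[p]) ∈ PadicInt.subring p ∧ (c₀ : ℚ_[p]) ∈ PadicInt.subring p := by
  obtain ⟨h1, h2, -, -⟩ := H.reductions_mem hirr hθ hx hd hd'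
  constructor
  · refine mem_padicSubring_of_mul (padicInt_not_dvd_mul (padicInt_not_dvd_two hp2) H.unit) ?_
    convert sub_mem h2 h1 using 1
    push_cast
    rw [h0, h0', padicInt_coe_two]
    push_cast
    ring
  · refine mem_padicSubring_of_mul (padicInt_not_dvd_four hp2) ?_
    convert add_mem h2 h1 using 1
    rw [h0, h0', padicInt_coe_four]
    push_cast
    ring

end PadicFactorization

/-- The criterion for the explicit family to be a `p`-integral basis. -/
theorem PadicFactorization.isPIntegralBasis {k k' : ℕ} (H : PadicFactorization p a b c l n w)
    (hirr : Irreducible (depressedQuartic a b c))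
    (hθ : aeval θ (depressedQuartic a b c) = 0) (hK : IntermediateField.adjoin ℚ {θ} = ⊤)
    (hp2 : 2 < p) {s : ℤ} (hs : (p : ℤ_[p]) ∣ 2 * s + l)
    (hreg : IsNewtonRegular p (depressedQuartic a b c) s) (hk : k ≤ k')
    (hk1 : (p : ℤ_[p]) ^ (2 * k') ∣ l ^ 2 - 4 * n) (hk2 : (p : ℤ_[p]) ^ (2 * k) ∣ l ^ 2 - 4 * w)
    (hd : ¬ (p : ℤ_[p]) ^ (2 * k' + 2) ∣ l ^ 2 - 4 * n)
    (hd' : ¬ (p : ℤ_[p]) ^ (2 * k + 2) ∣ l ^ 2 - 4 * w) :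
    IsPIntegralBasis p ![1, θ,
          (θ ^ 2 + (s : K) ^ 2 + (a : K)) / (p : K) ^ k,
          (θ ^ 3 + (s : K) * θ ^ 2 + ((a : K) + (s : K) ^ 2) * θ + (s : K) ^ 3
            + (a : K) * (s : K) + (b : K)) / (p : K) ^ k'] := by
  have hP := Nat.prime_iff_prime_int.1 hp.out
  have hp0 : (p : K) ≠ 0 := by exact_mod_cast hp.out.ne_zero
  have hpQ : (p : ℚ) ≠ 0 := by exact_mod_cast hp.out.ne_zero
  have hθ' : θ ^ 4 + a * θ ^ 2 + b * θ + c = 0 := by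
    simpa [depressedQuartic] using hθ
  have hθi : IsIntegral ℤ θ := ⟨_, depressedQuartic_monic a b c, hθ⟩
  obtain ⟨hf, hf'⟩ := (H.pow_dvd_dev_iff hp2 hs hreg k').2 hk1
  have hkk : (p : ℤ_[p]) ^ (2 * k) ∣ l ^ 2 - 4 * n := (pow_dvd_pow _ (by omega)).trans hk1
  obtain ⟨hfk, hfk'⟩ := (H.pow_dvd_dev_iff hp2 hs hreg k).2 hkk
  have hb := ((H.pow_dvd_and_iff hp2 _).1 ⟨hkk, hk2⟩).1
  have hg : (p : ℤ) ^ k ∣ 2 * s ^ 2 + a := by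
    rw [depressedQuartic_derivative_eval] at hfk'
    have e : 4 * s ^ 3 + 2 * a * s + b = (2 * s) * (2 * s ^ 2 + a) + b := by ring
    rw [e, dvd_add_left ((pow_dvd_pow _ (by omega)).trans hb)] at hfk'
    rw [← PadicInt.pow_p_dvd_int_iff] at hfk' ⊢
    push_cast at hfk' ⊢
    refine (padicInt_pow_dvd_mul_left fun h => H.unit ?_).1 hfk'
    rwa [dvd_add_right h] at hs
  have hω2 := isIntegral_quadratic_div hθ' hb hfk hg hθi
  have hω3 := isIntegral_cubic_div hθ' hf hf' hθi
  refine ⟨?_, ?_, ?_⟩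
  · intro i
    fin_cases i
    · exact isIntegral_one
    · exact hθi
    · exact hω2
    · exact hω3
  · rw [Fintype.linearIndependent_iff]
    intro g hg0
    simp only [Fin.sum_univ_four, Algebra.smul_def, eq_ratCast, Matrix.cons_val_zero,
      Matrix.cons_val_one, Matrix.cons_val] at hg0
    have := coefficients_eq_zero hirr hθ
      (c₀ := g 0 + g 2 * (s ^ 2 + a) / p ^ k + g 3 * (s ^ 3 + a * s + b) / p ^ k')
      (c₁ := g 1 + g 3 * (a + s ^ 2) / p ^ k') (c₂ := g 2 / p ^ k + g 3 * s / p ^ k')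
      (c₃ := g 3 / p ^ k') (by
        push_cast
        linear_combination hg0)
    obtain ⟨e0, e1, e2, e3⟩ := this
    have g3 : g 3 = 0 := by simpa [hpQ] using e3
    have g2 : g 2 = 0 := by simpa [hpQ, g3] using e2
    have g1 : g 1 = 0 := by simpa [g3] using e1
    have g0 : g 0 = 0 := by simpa [g3, g2] using e0
    intro i
    fin_cases i
    · exact g0
    · exact g1
    · exact g2
    · exact g3
  · intro x hx
    set ω2 := (θ ^ 2 + (s : K) ^ 2 + (a : K)) / (p : K) ^ k with hω2'
    set ω3 := (θ ^ 3 + (s : K) * θ ^ 2 + ((a : K) + (s : K) ^ 2) * θ + (s : K) ^ 3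
            + (a : K) * (s : K) + (b : K)) / (p : K) ^ k' with hω3'
    have hmul2 : (p : K) ^ k * ω2 = θ ^ 2 + s ^ 2 + a := mul_div_cancel₀ _ (pow_ne_zero _ hp0)
    have hmul3 : (p : K) ^ k' * ω3 = θ ^ 3 + s * θ ^ 2 + (a + s ^ 2) * θ + s ^ 3 + a * s + b :=
      mul_div_cancel₀ _ (pow_ne_zero _ hp0)
    have hZ : ∀ {d : ℤ} {y z : K}, IsIntegral ℤ y → IsIntegral ℤ z → ∀ e : ℤ,
        IsIntegral ℤ ((d : K) * y - e * z) := fun hy hz e =>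
      ((isIntegral_intCast _).mul hy).sub ((isIntegral_intCast _).mul hz)
    obtain ⟨c₀, c₁, c₂, c₃, rfl⟩ := exists_coefficients hirr hθ hK x
    obtain ⟨d3, e3, hd3, he3⟩ := exists_int_mul_of_mem_padicSubring (p := p)
      (q := (p : ℚ) ^ k' * c₃) (by
        push_cast
        exact H.coeff_three_mem hirr hθ hp2 hd hd' hx hk)
    have heK3 := congrArg (Rat.cast : ℚ → K) he3
    push_cast at heK3
    -- Triangular elimination: after scaling by d₃ prime to p, an integral multiple of ω₃ removes
    -- the θ³ term and integrality persists; ω₂ then removes the θ² term.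
    have hx1 : IsIntegral ℤ (((d3 * (c₀ - c₃ * (s ^ 3 + a * s + b)) : ℚ) : K)
        + ((d3 * (c₁ - c₃ * (a + s ^ 2)) : ℚ) : K) * θ + ((d3 * (c₂ - c₃ * s) : ℚ) : K) * θ ^ 2
        + ((0 : ℚ) : K) * θ ^ 3) := by
      refine (congrArg (IsIntegral ℤ) ?_).mpr (hZ (d := d3) hx hω3 e3)
      push_cast
      linear_combination -ω3 * heK3 + d3 * c₃ * hmul3
    obtain ⟨d2, e2, hd2, he2⟩ := exists_int_mul_of_mem_padicSubring (p := p)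
      (q := (p : ℚ) ^ k * (d3 * (c₂ - c₃ * s))) (by
        have := H.coeff_two_mem hirr hθ hp2 hd hd' hx1 rfl
        push_cast at this ⊢
        exact this)
    have heK2 := congrArg (Rat.cast : ℚ → K) he2
    push_cast at heK2
    have hx2 : IsIntegral ℤ
        (((d2 * (d3 * (c₀ - c₃ * (s ^ 3 + a * s + b)) - d3 * (c₂ - c₃ * s) * (s ^ 2 + a)) : ℚ) : K)
        + ((d2 * (d3 * (c₁ - c₃ * (a + s ^ 2))) : ℚ) : K) * θ + ((0 : ℚ) : K) * θ ^ 2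
        + ((0 : ℚ) : K) * θ ^ 3) := by
      refine (congrArg (IsIntegral ℤ) ?_).mpr (hZ (d := d2) hx1 hω2 e2)
      push_cast
      linear_combination -ω2 * heK2 + d2 * (d3 * (c₂ - c₃ * s)) * hmul2
    obtain ⟨h1, h0⟩ := H.coeff_one_zero_mem hirr hθ hp2 hd hd' hx2 rfl rfl
    obtain ⟨d1, e1, hd1, he1⟩ := exists_int_mul_of_mem_padicSubring h1
    obtain ⟨d0, e0, hd0, he0⟩ := exists_int_mul_of_mem_padicSubring h0
    have heK1 := congrArg (Rat.cast : ℚ → K) he1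
    have heK0 := congrArg (Rat.cast : ℚ → K) he0
    push_cast at heK1 heK0
    refine ⟨d0 * d1 * d2 * d3, ?_, ?_⟩
    · intro h
      rcases hP.dvd_or_dvd h with h | h
      · rcases hP.dvd_or_dvd h with h | h
        · rcases hP.dvd_or_dvd h with h | h
          · exact hd0 h
          · exact hd1 h
        · exact hd2 h
      · exact hd3 h
    · have hmem : ∀ i, (![1, θ, ω2, ω3] : Fin 4 → K) i
          ∈ Submodule.span ℤ (Set.range ![1, θ, ω2, ω3]) :=
        fun i => Submodule.subset_span ⟨i, rfl⟩
      have hsum := add_mem (add_mem (add_mem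
        (Submodule.smul_mem _ (d1 * e0) (hmem 0)) (Submodule.smul_mem _ (d0 * e1) (hmem 1)))
        (Submodule.smul_mem _ (d0 * d1 * e2) (hmem 2)))
        (Submodule.smul_mem _ (d0 * d1 * d2 * e3) (hmem 3))
      convert hsum using 1
      simp only [zsmul_eq_mul, Matrix.cons_val_zero, Matrix.cons_val_one, Matrix.cons_val]
      push_cast
      linear_combination d1 * heK0 + d0 * θ * heK1 + d0 * d1 * ω2 * heK2
        - d0 * d1 * d2 * (d3 * (c₂ - c₃ * s)) * hmul2
        + d0 * d1 * d2 * ω3 * heK3 - d0 * d1 * d2 * d3 * c₃ * hmul3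

end Basis

/-! ### Double roots modulo p and regular lifts. -/

section DoubleRoots

variable {p : ℕ} [hp : Fact p.Prime] {a b c : ℤ}

theorem depressedQuartic_map_zmod : (depressedQuartic a b c).map (Int.castRingHom (ZMod p))
    = depressedQuartic (a : ZMod p) (b : ZMod p) (c : ZMod p) := by
  simp [depressedQuartic_map]

theorem exists_root_of_double_roots (hp2 : 2 < p) (hb : (p : ℤ) ∣ b)
    {z w : ZMod p} (hzw : z ≠ w)
    (hz : ((depressedQuartic a b c).map (Int.castRingHom (ZMod p))).rootMultiplicity z = 2)
    (hw : ((depressedQuartic a b c).map (Int.castRingHom (ZMod p))).rootMultiplicity w = 2) :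
    ¬ (p : ℤ) ∣ a ∧ ∃ s : ℤ, (p : ℤ) ∣ 2 * s ^ 2 + a := by
  have h2 := zmod_two_ne_zero hp2
  rw [← ZMod.intCast_zmod_eq_zero_iff_dvd] at hb
  rw [depressedQuartic_map_zmod] at hz hw
  have h1 := derivative_eq_zero_of_rootMultiplicity_eq_two h2 hb hz
  have h1' := derivative_eq_zero_of_rootMultiplicity_eq_two h2 hb hw
  constructor
  · rw [← ZMod.intCast_zmod_eq_zero_iff_dvd]
    intro ha
    have key : ∀ x : ZMod p, x = 0 ∨ 2 * x ^ 2 + (a : ZMod p) = 0 → x = 0 := by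
      intro x hx
      rcases hx with hx | hx
      · exact hx
      · simpa [ha, h2] using hx
    exact hzw ((key z h1).trans (key w h1').symm)
  · have key : ∃ x : ZMod p, 2 * x ^ 2 + (a : ZMod p) = 0 := by
      rcases h1 with h1 | h1
      · rcases h1' with h1' | h1'
        · exact absurd (h1.trans h1'.symm) hzw
        · exact ⟨w, h1'⟩
      · exact ⟨z, h1⟩
    obtain ⟨x, hx⟩ := key
    obtain ⟨s, rfl⟩ := ZMod.intCast_surjective x
    refine ⟨s, ?_⟩
    rw [← ZMod.intCast_zmod_eq_zero_iff_dvd]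
    exact_mod_cast hx

theorem AreRegularLifts.dvd (hp2 : 2 < p) (hb : (p : ℤ) ∣ b) {s : ℤ}
    (h : AreRegularLifts p (depressedQuartic a b c) s (-s)) : (p : ℤ) ∣ 2 * s ^ 2 + a := by
  rw [← ZMod.intCast_zmod_eq_zero_iff_dvd] at hb ⊢
  have h1 := h.left_double
  rw [depressedQuartic_map_zmod] at h1
  rcases derivative_eq_zero_of_rootMultiplicity_eq_two (zmod_two_ne_zero hp2) hb h1 with h0 | h0
  · exact absurd (by simp [h0]) h.ne
  · exact_mod_cast h0

theorem areRegularLifts_of_dvd (hp2 : 2 < p) (ha : ¬ (p : ℤ) ∣ a) (hb : (p : ℤ) ∣ b)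
    (hD : (p : ℤ) ∣ a ^ 2 - 4 * c) {s : ℤ} (hs : (p : ℤ) ∣ 2 * s ^ 2 + a)
    (hr : IsNewtonRegular p (depressedQuartic a b c) s)
    (hr' : IsNewtonRegular p (depressedQuartic a b c) (-s)) :
    AreRegularLifts p (depressedQuartic a b c) s (-s) := by
  have h2 := zmod_two_ne_zero hp2
  rw [← ZMod.intCast_zmod_eq_zero_iff_dvd] at ha hb hD hs
  push_cast at hD hs
  refine ⟨?_, ?_, ?_, hr, hr'⟩
  · rw [depressedQuartic_map_zmod]
    exact rootMultiplicity_depressedQuartic_eq_two h2 ha hb hD hs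
  · rw [depressedQuartic_map_zmod]
    exact rootMultiplicity_depressedQuartic_eq_two h2 ha hb hD (by push_cast; rwa [neg_sq])
  · intro h
    push_cast at h
    have h0 : 2 * (s : ZMod p) = 0 := by linear_combination h
    have h0' : (s : ZMod p) = 0 := (mul_eq_zero.1 h0).resolve_left h2
    apply ha
    simpa [h0'] using hs

end DoubleRoots

/-! ### The exponents ν₊, ν₋ and termination of the iteration. -/

section Exponents

variable {p : ℕ} [hp : Fact p.Prime] {a b c : ℤ} {l n w : ℤ_[p]}

namespace PadicFactorization

variable (H : PadicFactorization p a b c l n w)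
include H

omit H in
theorem dvd_neg_center {s : ℤ} (hs : (p : ℤ_[p]) ∣ 2 * s + l) :
    (p : ℤ_[p]) ∣ 2 * ((-s : ℤ) : ℤ_[p]) + -l := by
  have e : 2 * ((-s : ℤ) : ℤ_[p]) + -l = -(2 * s + l) := by push_cast; ring
  rw [e]
  exact (dvd_neg).2 hs

theorem isNewtonRegular_neg_iff (hp2 : 2 < p) {s : ℤ} (hs : (p : ℤ_[p]) ∣ 2 * s + l) :
    IsNewtonRegular p (depressedQuartic a b c) (-s) ↔ l ^ 2 - 4 * w ∣ (2 * s + l) ^ 2 := by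
  rw [H.symm.isNewtonRegular_iff hp2 (dvd_neg_center hs), neg_sq]
  have e : 2 * ((-s : ℤ) : ℤ_[p]) + -l = -(2 * s + l) := by push_cast; ring
  rw [e, neg_sq]

theorem discr_ne_zero (hirr : Irreducible (depressedQuartic a b c)) :
    l ^ 2 - 4 * n ≠ 0 ∧ l ^ 2 - 4 * w ≠ 0 := by
  have h0 := discr_ne_zero_of_irreducible (depressedQuartic_monic a b c) hirr
  have h1 : ((depressedQuartic a b c).discr : ℤ_[p]) ≠ 0 := by exact_mod_cast h0
  rw [H.discr_eq] at h1
  exact mul_ne_zero_iff.1 (left_ne_zero_of_mul h1)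

theorem valuation_add (hp2 : 2 < p) (hirr : Irreducible (depressedQuartic a b c)) :
    (l ^ 2 - 4 * n).valuation + (l ^ 2 - 4 * w).valuation
      = padicValInt p (depressedQuartic a b c).discr := by
  have h0 := discr_ne_zero_of_irreducible (depressedQuartic_monic a b c) hirr
  obtain ⟨h1, h2⟩ := H.discr_ne_zero hirr
  have key : ∀ k, k ≤ padicValInt p (depressedQuartic a b c).discr ↔
      k ≤ (l ^ 2 - 4 * n).valuation + (l ^ 2 - 4 * w).valuation := by
    intro k
    rw [← PadicInt.valuation_mul h1 h2, ← padicInt_pow_dvd_iff (mul_ne_zero h1 h2),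
      ← padicInt_pow_dvd_mul_right (padicInt_not_dvd_pow (H.not_dvd_resultant hp2) 2),
      ← H.discr_eq, PadicInt.pow_p_dvd_int_iff, padicValInt_dvd_iff]
    simp [h0]
  exact le_antisymm ((key _).2 le_rfl) ((key _).1 le_rfl)

theorem valuation_min (hp2 : 2 < p) (hirr : Irreducible (depressedQuartic a b c))
    {A B : ℤ} {m m' : ℕ} (E : ExactPowers p a b c A B m m') :
    min (l ^ 2 - 4 * n).valuation (l ^ 2 - 4 * w).valuation = min m m' := by
  obtain ⟨h1, h2⟩ := H.discr_ne_zero hirr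
  have key : ∀ k, (k ≤ (l ^ 2 - 4 * n).valuation ∧ k ≤ (l ^ 2 - 4 * w).valuation) ↔
      (k ≤ m ∧ k ≤ m') := by
    intro k
    rw [← padicInt_pow_dvd_iff h1, ← padicInt_pow_dvd_iff h2, H.pow_dvd_and_iff hp2,
      E.pow_dvd_b, E.pow_dvd_D]
  refine le_antisymm (le_min_iff.2 ((key _).1 ?_)) (le_min_iff.2 ((key _).2 ?_))
  · exact ⟨min_le_left _ _, min_le_right _ _⟩
  · exact ⟨min_le_left _ _, min_le_right _ _⟩

theorem nuExp_eq (hp2 : 2 < p) (hirr : Irreducible (depressedQuartic a b c)) {s : ℤ}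
    (hs : (p : ℤ_[p]) ∣ 2 * s + l) (hreg : IsNewtonRegular p (depressedQuartic a b c) s) :
    nuExp p (depressedQuartic a b c) s = (l ^ 2 - 4 * n).valuation / 2 := by
  refine nuExp_eq_of_forall fun N => ?_
  rw [H.pow_dvd_dev_iff hp2 hs hreg, padicInt_pow_dvd_iff (H.discr_ne_zero hirr).1]
  omega

theorem nuExp_neg_eq (hp2 : 2 < p) (hirr : Irreducible (depressedQuartic a b c)) {s : ℤ}
    (hs : (p : ℤ_[p]) ∣ 2 * s + l) (hreg : IsNewtonRegular p (depressedQuartic a b c) (-s)) :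
    nuExp p (depressedQuartic a b c) (-s) = (l ^ 2 - 4 * w).valuation / 2 := by
  have := H.symm.nuExp_eq hp2 hirr (dvd_neg_center hs) hreg
  rwa [neg_sq] at this

theorem pow_dvd_of_isIterate (hp2 : 2 < p) {s t : ℤ} (hs : (p : ℤ_[p]) ∣ 2 * s + l)
    (ht : IsIterate p (depressedQuartic a b c) s t) {k : ℕ} (hk : (p : ℤ_[p]) ^ k ∣ 2 * s + l) :
    (p : ℤ_[p]) ∣ 2 * t + l ∧ (p : ℤ_[p]) ^ k ∣ 2 * t + l := by
  induction ht with
  | refl => exact ⟨hs, hk⟩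
  | tail _ st ih =>
    refine ⟨(pow_one (p : ℤ_[p])) ▸ H.pow_dvd_of_iterStep hp2 ih.1 st (k := 0) (by simp), ?_⟩
    exact (pow_dvd_pow _ (Nat.le_succ k)).trans (H.pow_dvd_of_iterStep hp2 ih.1 st ih.2)

/-- If σ never became regular, p^(k+1) would divide 2σ(k) + l for all k. At k = v(l² - 4n) this
contradicts irregularity, which requires 2v(2σ(k) + l) + 1 ≤ v(l² - 4n). -/
theorem exists_isNewtonRegular (hp2 : 2 < p) (hirr : Irreducible (depressedQuartic a b c))
    {σ : ℕ → ℤ} (hs : (p : ℤ_[p]) ∣ 2 * σ 0 + l)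
    (hσ : ∀ n, ¬ IsNewtonRegular p (depressedQuartic a b c) (σ n) →
      IterStep p (depressedQuartic a b c) (σ n) (σ (n + 1))) :
    ∃ n, IsNewtonRegular p (depressedQuartic a b c) (σ n) := by
  by_contra! hcon
  have hdvd : ∀ k, (p : ℤ_[p]) ^ (k + 1) ∣ 2 * σ k + l := by
    intro k
    induction k with
    | zero => simpa using hs
    | succ k ih =>
      exact H.pow_dvd_of_iterStep hp2 ((dvd_pow_self _ (Nat.succ_ne_zero k)).trans ih)
        (hσ k (hcon k)) ih
  set v := (l ^ 2 - 4 * n).valuation with hv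
  have h1 := hcon v
  obtain ⟨h, h2, h3, h4⟩ := (H.not_isNewtonRegular_iff hp2
    ((dvd_pow_self _ (Nat.succ_ne_zero v)).trans (hdvd v))).1 h1
  rw [padicInt_pow_dvd_iff (H.discr_ne_zero hirr).1, ← hv] at h4
  exact h3 ((pow_dvd_pow _ (by omega)).trans (hdvd v))

end PadicFactorization

end Exponents

/-! ### Assembly of the three statements. -/

theorem lemma4p1 (p : ℕ) [Fact p.Prime] (hp : 2 < p) (a b c : ℤ) (f : ℤ[X])
    (hf : f = X ^ 4 + C a * X ^ 2 + C b * X + C c) (hirr : Irreducible f)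
    (K : Type*) [Field K] [NumberField K] (θ : K) (hθ : aeval θ f = 0)
    (hK : IntermediateField.adjoin ℚ {θ} = ⊤)
    (hdouble : ∃ z w : ZMod p, z ≠ w ∧
      (f.map (Int.castRingHom (ZMod p))).rootMultiplicity z = 2 ∧
      (f.map (Int.castRingHom (ZMod p))).rootMultiplicity w = 2)
    (A B : ℤ) (m m' : ℕ) (hm : 0 < m) (hm' : 0 < m')
    (hB : ¬ (p : ℤ) ∣ B) (hA : ¬ (p : ℤ) ∣ A)
    (hb : b = B * (p : ℤ) ^ m) (hac : a ^ 2 - 4 * c = A * (p : ℤ) ^ m')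
    (r : ℕ) (hr : r = min m m')
    (δ : ℕ∞) (hδ : δ = emultiplicity (p : ℤ) (A ^ 2 + 8 * a * B ^ 2))
    (Δ : ℕ) (hΔ : Δ = padicValInt p f.discr) :
    -- regularity of sufficiently good approximations
    (∀ s : ℤ, (p : ℤ) ^ (r + 1) ∣ 2 * s ^ 2 + a → (m ≠ m' ∨ (r : ℕ∞) ≠ δ) →
      AreRegularLifts p f s (-s)) ∧
    -- the iteration in the remaining case
    (∀ s : ℤ, (p : ℤ) ^ (r + 1) ∣ 2 * s ^ 2 + a → m = m' → (m' : ℕ∞) = δ → ¬ IsNewtonRegular p f s →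
      (∀ t, IsIterate p f s t → ¬ IsNewtonRegular p f t → ∃ t', IterStep p f t t') ∧
      (∀ σ : ℕ → ℤ, σ 0 = s → (∀ n, ¬ IsNewtonRegular p f (σ n) → IterStep p f (σ n) (σ (n + 1))) →
        ∃ n, IsNewtonRegular p f (σ n)) ∧
      (∀ t, IsIterate p f s t → IsNewtonRegular p f (-t)) ∧
      (∀ t, IsIterate p f s t → IsNewtonRegular p f t → AreRegularLifts p f t (-t))) ∧
    -- the exponents, and the basis
    r ≤ Δ ∧
    (∀ s : ℤ, AreRegularLifts p f s (-s) →
      min (nuExp p f (-s)) (nuExp p f s) = r / 2 ∧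
      max (nuExp p f (-s)) (nuExp p f s) = (Δ - r) / 2 ∧
      (nuExp p f (-s) ≤ nuExp p f s →
        IsPIntegralBasis p ![1, θ,
          (θ ^ 2 + (s : K) ^ 2 + (a : K)) / (p : K) ^ (r / 2),
          (θ ^ 3 + (s : K) * θ ^ 2 + ((a : K) + (s : K) ^ 2) * θ + (s : K) ^ 3
            + (a : K) * (s : K) + (b : K)) / (p : K) ^ ((Δ - r) / 2)])) := by

  have hf' : f = depressedQuartic a b c := hf
  clear hf
  subst hf'
  have E : ExactPowers p a b c A B m m' := ⟨hB, hA, hb, hac⟩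
  have hpb : (p : ℤ) ∣ b := by simpa using (E.pow_dvd_b 1).2 hm
  have hpD : (p : ℤ) ∣ a ^ 2 - 4 * c := by simpa using (E.pow_dvd_D 1).2 hm'
  obtain ⟨z, w₀, hzw, hz, hw⟩ := hdouble
  obtain ⟨ha, s₀, hs₀⟩ := exists_root_of_double_roots hp hpb hzw hz hw
  have hr0 : 0 < r := by omega
  have hb_r : (p : ℤ) ^ r ∣ b := (E.pow_dvd_b r).2 (by omega)
  have hD_r : (p : ℤ) ^ r ∣ a ^ 2 - 4 * c := (E.pow_dvd_D r).2 (by omega)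
  subst hδ hΔ
  refine ⟨?_, ?_, ?_, ?_⟩
  · intro s hs hδ
    have hs1 : (p : ℤ) ∣ 2 * s ^ 2 + a := (dvd_pow_self _ (Nat.succ_ne_zero r)).trans hs
    obtain ⟨l, n, w, H, hl⟩ := exists_padicFactorization hp ha hpb hpD hs1
    have hlam := H.pow_dvd_of_approx hp hl ((pow_dvd_pow _ (Nat.le_succ r)).trans hs) hb_r hD_r
    have hsq : (p : ℤ_[p]) ^ (2 * r) ∣ (2 * s + l) ^ 2 := by
      rw [mul_comm, pow_mul]
      exact pow_dvd_pow_of_dvd hlam 2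
    refine areRegularLifts_of_dvd hp ha hpb hpD hs1 ((H.isNewtonRegular_iff hp hl).2 ?_)
      ((H.isNewtonRegular_neg_iff hp hl).2 ?_)
    · exact padicInt_dvd_of_pow_dvd (E.not_pow_dvd_discr hp H hr hr0 hδ) hsq
    · have := E.not_pow_dvd_discr hp H.symm hr hr0 hδ
      rw [neg_sq] at this
      exact padicInt_dvd_of_pow_dvd this hsq
  · intro s hs hmm hδ hirreg
    have hs1 : (p : ℤ) ∣ 2 * s ^ 2 + a := (dvd_pow_self _ (Nat.succ_ne_zero r)).trans hs
    obtain ⟨l, n, w, H, hl⟩ := exists_padicFactorization hp ha hpb hpD hs1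
    have hlam := H.pow_dvd_of_approx hp hl ((pow_dvd_pow _ (Nat.le_succ r)).trans hs) hb_r hD_r
    -- Irregularity of s makes p^(2r+1) divide l² - 4n, so the minimum r is attained by the other
    -- discriminant alone. As p^r divides 2t + l for every iterate t, this keeps -t regular.
    have hw' : ¬ (p : ℤ_[p]) ^ (r + 1) ∣ l ^ 2 - 4 * w := by
      obtain ⟨h, h1, h2, h3⟩ := (H.not_isNewtonRegular_iff hp hl).1 hirreg
      have hrh : r ≤ h := by
        by_contra hcon
        exact h2 ((pow_dvd_pow _ (by omega)).trans hlam)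
      intro hcon
      have := ((H.pow_dvd_and_iff hp (r + 1)).1 ⟨(pow_dvd_pow _ (by omega)).trans h3, hcon⟩).1
      rw [E.pow_dvd_b] at this
      omega
    have hneg : ∀ t, IsIterate p (depressedQuartic a b c) s t →
        IsNewtonRegular p (depressedQuartic a b c) (-t) := by
      intro t ht
      obtain ⟨ht1, ht2⟩ := H.pow_dvd_of_isIterate hp hl ht hlam
      rw [H.isNewtonRegular_neg_iff hp ht1]
      exact padicInt_dvd_of_pow_dvd hw' (ht2.trans (dvd_pow_self _ two_ne_zero))
    refine ⟨?_, ?_, hneg, ?_⟩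
    · intro t ht hirr_t
      have ht1 := (H.pow_dvd_of_isIterate hp hl ht hlam).1
      exact exists_iterStep hp (H.not_dvd_devCoeff_two hp ht1) (H.dvd_devCoeff_zero hp ht1) hirr_t
    · intro σ hσ0 hσ
      exact H.exists_isNewtonRegular hp hirr (by rwa [hσ0]) hσ
    · intro t ht htr
      have ht1 := (H.pow_dvd_of_isIterate hp hl ht hlam).1
      exact areRegularLifts_of_dvd hp ha hpb hpD (H.dvd_double hp ht1) htr (hneg t ht)
  · obtain ⟨l, n, w, H, -⟩ := exists_padicFactorization hp ha hpb hpD hs₀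
    have h1 := H.valuation_add hp hirr
    have h2 := H.valuation_min hp hirr E
    omega
  · intro s hs
    obtain ⟨l, n, w, H, hl⟩ := exists_padicFactorization hp ha hpb hpD (hs.dvd hp hpb)
    have h1 := H.valuation_add hp hirr
    have h2 := H.valuation_min hp hirr E
    rw [H.nuExp_eq hp hirr hl hs.left_regular, H.nuExp_neg_eq hp hirr hl hs.right_regular]
    obtain ⟨h3, h4⟩ := H.discr_ne_zero hirr
    refine ⟨by omega, by omega, fun hle => ?_⟩
    -- The order of ν₋ and ν₊ only compares halved valuations. If v(l² - 4w) exceeds v(l² - 4n)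
    -- nevertheless, the halves coincide, so the exponents are still r/2 and (Δ - r)/2.
    refine H.isPIntegralBasis hirr hθ hK hp hl hs.left_regular (by omega) ?_ ?_ ?_ ?_
    · rw [padicInt_pow_dvd_iff h3]
      omega
    · rw [padicInt_pow_dvd_iff h4]
      omega
    · rw [padicInt_pow_dvd_iff h3]
      omega
    · rw [padicInt_pow_dvd_iff h4]
      omega
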